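/- Let $n\ge 2$, let $X$ be a smooth manifold of dimension $n$, let $f_0,f_1,\dots,f_{n-1}$ be $C^\infty$ vector fields on $X$, and consider the control affine system $$\dot x = g(x,u) := f_0(x)+\sum_{j=1}^{n-1}u_j f_j(x),\qquad x\in X,\ u\in\mathbb R^{n-1}.$$ *Flat outputs.* For a manifold $Y$, let $Y\times\mathbb R^{n-1}_\infty$ be the space of all $(y,\overline v)=(y,v,\dot v,\ddot v,\dots)$ with the product topology; a map from a subset of it to a manifold is called smooth if it depends on finitely many coordinates only and is $C^\infty$ in them, and a map into $Y\times\mathbb R^{n-1}_\infty$ is smooth if each of its components is. On $X\times\mathbb R^{n-1}_\infty$ consider the Cartan field $C_g=g\,\partial_x+\sum_{j\ge0}u^{(j+1)}\partial_{u^{(j)}}$, and on the space $\mathbb R^{n-1}_\infty$ of sequences $(y,\dot y,\ddot y,\dots)$ the trivial Cartan field $\tau=\sum_{j\ge 0}y^{(j+1)}\partial_{y^{(j)}}$. A function $h$ with values in $\mathbb R^{n-1}$ is a *flat output* on an open set $\mathfrak U\subset X\times\mathbb R^{n-1}_\infty$ if there are an open set $\mathfrak V\subset\mathbb R^{n-1}_\infty$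 and a smooth bijection $\Psi:\mathfrak U\to\mathfrak V$ with smooth inverse $\Phi$, such that $\Psi_*C_g=\tau$ and $\Phi_*\tau=C_g$, whose $y$-component is $h$. *Theorem.* Let $(x_0,u_0)\in X\times\mathbb R^{n-1}$ and $k\in\{1,\dots,n-1\}$ be such that, for all $(x,u)$ in a neighborhood of $(x_0,u_0)$, $$\mathrm{Span}\{f_1(x),\dots,f_{n-1}(x),[g(\cdot,u),f_k](x)\}=T_xX .$$ Let $\psi=(\psi_1,\dots,\psi_{n-1})$ be $C^\infty$ first integrals of $f_k$ on an open neighborhood $U$ of $x_0$ (that is, $L_{f_k}\psi_i=0$ on $U$) whose differentials at $x_0$ are linearly independent. Then there is an open neighborhood $W$ of $(x_0,u_0)$ in $X\times\mathbb R^{n-1}$, with $x\in U$ for all $(x,u)\in W$, such that: 1. $z=\psi(x)$ is a flat output on $\{(x,u,\dot u,\dots):(x,u)\in W\}$. 2. Write $\dot z=L_g\psi$, a function of $(x,u)$, and $\ddot z=C_g\dot z$, a function of $(x,u,\dot u)$. For $(x,u)\in W$, $\ddot z$ does not depend on $\dot u_k$. The map $$(x,u,(\dot u_i)_{i\ne k})\longmapsto(z,\dot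 z,\ddot z)\in\mathbb R^{3(n-1)}$$ has an invertible differential at every point of $W\times\mathbb R^{n-2}$, and it is a $C^\infty$ diffeomorphism from $W\times\mathbb R^{n-2}$ onto an open subset of $\mathbb R^{3(n-1)}$. In particular $x$ and $u$ are $C^\infty$ functions of $(z,\dot z,\ddot z)$. -/

import Mathlib

open scoped Manifold ContDiff Topology

noncomputable section

namespace FlatSystems

/-- The sequences `(u, u', u'', ...)` of derivatives of an `m`-dimensional input,
with the product topology. -/
abbrev Jets (m : ℕ) : Type := ℕ → Fin m → ℝ

/-- Truncation of a point `(x, u, u', ...)` to `(x, u, ..., u^(N-1))`. -/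
def trunc {X : Type*} {m : ℕ} (N : ℕ) (p : X × Jets m) : X × (Fin N → Fin m → ℝ) :=
  (p.1, fun j => p.2 j)

section Jets

variable {E H X : Type*} [NormedAddCommGroup E] [NormedSpace ℝ E] [TopologicalSpace H]
  [TopologicalSpace X] [ChartedSpace H X]
  {E' H' Y : Type*} [NormedAddCommGroup E'] [NormedSpace ℝ E'] [TopologicalSpace H']
  [TopologicalSpace Y] [ChartedSpace H' Y] {m μ : ℕ}

/-- A map from a subset `S` of the infinite jet space `X × Jets m` to a manifold `Y` is smooth if
it depends on finitely many coordinates only, and smoothly so. -/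
def SmoothOn (I : ModelWithCorners ℝ E H) (I' : ModelWithCorners ℝ E' H')
    (h : X × Jets m → Y) (S : Set (X × Jets m)) : Prop :=
  ∃ (N : ℕ) (F : X × (Fin N → Fin m → ℝ) → Y),
    ContMDiffOn (I.prod 𝓘(ℝ, Fin N → Fin m → ℝ)) I' ∞ F (trunc N '' S) ∧
      ∀ p ∈ S, h p = F (trunc N p)

/-- `h` depends near `p` on finitely many coordinates only, differentiably so at `p`, and its
differential at `p` sends the tangent vector `(v, w)` of `X × Jets m` to `d`, that is,
`∂h/∂x (p) v + ∑ⱼ ∂h/∂u^(j) (p) wⱼ = d`. -/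
def HasDerivAlong (I : ModelWithCorners ℝ E H) (I' : ModelWithCorners ℝ E' H')
    (h : X × Jets m → Y) (p : X × Jets m) (v : TangentSpace I p.1) (w : Jets m)
    (d : TangentSpace I' (h p)) : Prop :=
  ∃ (N : ℕ) (F : X × (Fin N → Fin m → ℝ) → Y)
    (F' : E × (Fin N → Fin m → ℝ) →L[ℝ] E'),
    (∀ᶠ q in 𝓝 p, h q = F (trunc N q)) ∧
      HasMFDerivAt (I.prod 𝓘(ℝ, Fin N → Fin m → ℝ)) I' F (trunc N p) F' ∧
      F' (v, fun j => w j) = d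

/-- A map `Ψ` between infinite jet spaces is smooth if all its components are. -/
def SmoothJetMapOn (I : ModelWithCorners ℝ E H) (I' : ModelWithCorners ℝ E' H')
    (Ψ : X × Jets m → Y × Jets μ) (S : Set (X × Jets m)) : Prop :=
  SmoothOn I I' (fun p => (Ψ p).1) S ∧
    ∀ j : ℕ, SmoothOn I 𝓘(ℝ, Fin μ → ℝ) (fun p => (Ψ p).2 j) S

/-- The Cartan field `g ∂/∂x + ∑ⱼ u^(j+1) ∂/∂u^(j)` of the system `x' = g(x, u)`, as a tangent
vector at `p = (x, u, u', ...)`. -/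
def cartan (I : ModelWithCorners ℝ E H) (g : (x : X) → (Fin m → ℝ) → TangentSpace I x)
    (p : X × Jets m) : TangentSpace I p.1 × Jets m :=
  (g p.1 (p.2 0), fun j => p.2 (j + 1))

/-- The Cartan fields of `x' = g(x, u)` and `y' = γ(y, v)` are `Ψ`-related on `S`: the differential
of `Ψ` sends the first one at `p` to the second one at `Ψ p`. -/
def CartanRelatedOn (I : ModelWithCorners ℝ E H) (I' : ModelWithCorners ℝ E' H')
    (g : (x : X) → (Fin m → ℝ) → TangentSpace I x)
    (γ : (y : Y) → (Fin μ → ℝ) → TangentSpace I' y)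
    (Ψ : X × Jets m → Y × Jets μ) (S : Set (X × Jets m)) : Prop :=
  ∀ p ∈ S,
    HasDerivAlong I I' (fun q => (Ψ q).1) p (cartan I g p).1 (cartan I g p).2
        (cartan I' γ (Ψ p)).1 ∧
      ∀ j : ℕ, HasDerivAlong I 𝓘(ℝ, Fin μ → ℝ) (fun q => (Ψ q).2 j) p
        (cartan I g p).1 (cartan I g p).2 ((cartan I' γ (Ψ p)).2 j)

/-- `Ψ` is a Lie-Bäcklund isomorphism, with inverse `Φ`, from the open set `S` of the jet space of
the system `x' = g(x, u)` onto the open set `T` of the jet space of `y' = γ(y, v)`. -/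
structure IsLieBacklundIso (I : ModelWithCorners ℝ E H) (I' : ModelWithCorners ℝ E' H')
    (g : (x : X) → (Fin m → ℝ) → TangentSpace I x)
    (γ : (y : Y) → (Fin μ → ℝ) → TangentSpace I' y)
    (S : Set (X × Jets m)) (T : Set (Y × Jets μ))
    (Ψ : X × Jets m → Y × Jets μ) (Φ : Y × Jets μ → X × Jets m) : Prop where
  isOpen_source : IsOpen S
  isOpen_target : IsOpen T
  mapsTo : Set.MapsTo Ψ S T
  mapsTo_inv : Set.MapsTo Φ T S
  invOn : Set.InvOn Φ Ψ S T
  smooth : SmoothJetMapOn I I' Ψ S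
  smooth_inv : SmoothJetMapOn I' I Φ T
  related : CartanRelatedOn I I' g γ Ψ S
  related_inv : CartanRelatedOn I' I γ g Φ T

/-- The trivial system `y' = v`. Its jet space, with coordinates `(y, (y', y'', ...))`, is the space
of all sequences `(y, y', y'', ...)`, and its Cartan field is the trivial one,
`∑ⱼ y^(j+1) ∂/∂y^(j)`. -/
def trivialSystem (m : ℕ) (y v : Fin m → ℝ) : TangentSpace 𝓘(ℝ, Fin m → ℝ) y := v

/-- The generalized output `h(x, u, u', ...)` of the system `x' = g(x, u)` is a flat output on `S`:
it is the `y`-component of a Lie-Bäcklund isomorphism from `S` onto an open set of the jet space of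
the trivial system. -/
def IsFlatOutputOn (I : ModelWithCorners ℝ E H)
    (g : (x : X) → (Fin m → ℝ) → TangentSpace I x)
    (h : X × Jets m → Fin m → ℝ) (S : Set (X × Jets m)) : Prop :=
  ∃ (T : Set ((Fin m → ℝ) × Jets m)) (Ψ : X × Jets m → (Fin m → ℝ) × Jets m)
    (Φ : (Fin m → ℝ) × Jets m → X × Jets m),
    IsLieBacklundIso I 𝓘(ℝ, Fin m → ℝ) g (trivialSystem m) S T Ψ Φ ∧
      ∀ p ∈ S, (Ψ p).1 = h p

/-- The set of all `(x, u, u', ...)` with `(x, u) ∈ W`. -/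
def cylinder (W : Set (X × (Fin m → ℝ))) : Set (X × Jets m) :=
  {p | (p.1, p.2 0) ∈ W}

end Jets

section Fields

variable {E H X : Type*} [NormedAddCommGroup E] [NormedSpace ℝ E] [TopologicalSpace H]
  [TopologicalSpace X] [ChartedSpace H X] {m : ℕ}

/-- The vector field `V` on `X` is of class `C^∞`. -/
def SmoothField (I : ModelWithCorners ℝ E H) [IsManifold I 1 X]
    (V : (x : X) → TangentSpace I x) : Prop :=
  ContMDiff I I.tangent ∞ (fun x => (⟨x, V x⟩ : TangentBundle I X))

/-- The control affine dynamics `g(x, u) = f₀(x) + ∑ⱼ uⱼ fⱼ(x)`. -/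
def affine (I : ModelWithCorners ℝ E H) (f₀ : (x : X) → TangentSpace I x)
    (f : Fin m → (x : X) → TangentSpace I x) (x : X) (u : Fin m → ℝ) : TangentSpace I x :=
  f₀ x + ∑ j, u j • f j x

/-- The differential at `x` of a real function. -/
def differential (I : ModelWithCorners ℝ E H) (h : X → ℝ) (x : X) : TangentSpace I x →L[ℝ] ℝ :=
  mfderiv I 𝓘(ℝ, ℝ) h x

/-- `h` is a (smooth) first integral of the vector field `V` on `U`. -/
structure IsFirstIntegralOn (I : ModelWithCorners ℝ E H) (V : (x : X) → TangentSpace I x)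
    (h : X → ℝ) (U : Set X) : Prop where
  smooth : ContMDiffOn I 𝓘(ℝ, ℝ) ∞ h U
  lieDeriv_eq_zero : ∀ x ∈ U, differential I h x (V x) = 0

/-- The first time derivative of `z = ψ(x)` along the system, `z' = L_g ψ`, a function
of `(x, u)`. -/
def zDot (I : ModelWithCorners ℝ E H) (g : (x : X) → (Fin m → ℝ) → TangentSpace I x)
    (ψ : Fin m → X → ℝ) (q : X × (Fin m → ℝ)) : Fin m → ℝ :=
  fun i => differential I (ψ i) q.1 (g q.1 q.2)

/-- The second time derivative of `z = ψ(x)` along the system, a function of `(x, u)` and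
of `u' = w`. -/
def zDDot (I : ModelWithCorners ℝ E H) (g : (x : X) → (Fin m → ℝ) → TangentSpace I x)
    (ψ : Fin m → X → ℝ) (q : X × (Fin m → ℝ)) (w : Fin m → ℝ) : Fin m → ℝ :=
  fun i => differential (I.prod 𝓘(ℝ, Fin m → ℝ)) (fun q' => zDot I g ψ q' i) q (g q.1 q.2, w)

/-- Completes `(wᵢ)_{i ≠ k}` by `w_k = 0`. -/
def extendZero (k : Fin m) (w : {i : Fin m // i ≠ k} → ℝ) : Fin m → ℝ :=
  fun i => if hi : i ≠ k then w ⟨i, hi⟩ else 0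

/-- The map `(x, u, (uᵢ')_{i ≠ k}) ↦ (z, z', z'')`, with `z''` taken at `u_k' = 0`. -/
def zJet (I : ModelWithCorners ℝ E H) (g : (x : X) → (Fin m → ℝ) → TangentSpace I x)
    (ψ : Fin m → X → ℝ) (k : Fin m) (q : (X × (Fin m → ℝ)) × ({i : Fin m // i ≠ k} → ℝ)) :
    (Fin m → ℝ) × (Fin m → ℝ) × (Fin m → ℝ) :=
  (fun i => ψ i q.1.1, zDot I g ψ q.1, zDDot I g ψ q.1 (extendZero k q.2))

end Fields

end FlatSystems

end

/-!
Let `K` be the set of indices `i ≠ k`. Since `L_{f_k} ψ = 0`, the derivative `z' = L_g ψ` does not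
depend on `u_k`, so that `(z, z')` is a function `F` of the reduced variables `(x, (uᵢ)_{i ∈ K})`,
which are as many as the components of `(z, z')`. The spanning condition makes the differential of
`F` injective: `dψ` has the line `ℝ f_k` as its kernel, `∂z'/∂uᵢ = dψ(fᵢ)`, and
`L_{f_k} z' = -dψ([g, f_k])` by the symmetry of second derivatives
(`LocalSystem.fderiv_F_injective`). By the inverse function theorem `F` has a local inverse `R`
(`LocalSystem.exists_reducedChart`).

The rest is explicit. Put `(a, b) = dR(z, z') (z', z'')`, the velocity of the reduced variables.
Applying `dψ` shows that `a - g(x, u)|_{u_k = 0}` is a multiple of `f_k`, and `u_k` is the factor;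
it is read off with a linear form `ℓ` that does not vanish on `f_k`. Then `x' = a = g(x, u)` and
`b = (uᵢ')_{i ∈ K}`, so that `(z, z', z'') ↦ (x, u, b)` is a smooth inverse of
`(x, u, (uᵢ')_{i ∈ K}) ↦ (z, z', z'')`, for all values of `u_k` and `z''`
(`LocalSystem.ReducedChart.velocity_fst`, `zd_control`, `zdd_control`, `control_zdd`).

For the flat output, `Ψ` collects the derivatives of `ψ` along the Cartan field of the system, and
`Φ` consists of `x` and the derivatives of `u` along the trivial Cartan field. By construction `Ψ`
and `Φ` relate the Cartan fields, the equation for `x` being `x' = g(x, u)` above. Differentiating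
`u ∘ Ψ = u` and `z ∘ Φ = z` repeatedly along the Cartan fields shows that they are inverse to each
other (`LocalSystem.ReducedChart.invOn_toTrivial`).

All this is done in the chart at `x₀`, on a vector space. Derivatives along Cartan fields are line
derivatives there, which do not depend on how a function is written in finitely many coordinates.
The results are then composed with the chart; the differential of the chart at its base point is
the identity, so the bracket on the manifold at `x₀` is the bracket in coordinates.
-/

noncomputable section

namespace FlatSystems

/-! ### Control affine systems in coordinates -/

section Linear

variable {m : ℕ}

/-- Completion of `(wᵢ)_{i ≠ k}` by `w_k = 0`, as a continuous linear map. -/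
def extendCLM (k : Fin m) : ({i : Fin m // i ≠ k} → ℝ) →L[ℝ] (Fin m → ℝ) :=
  ContinuousLinearMap.pi fun i =>
    if h : i ≠ k then ContinuousLinearMap.proj (⟨i, h⟩ : {i : Fin m // i ≠ k}) else 0

/-- The projection forgetting the `k`-th coordinate. -/
def forgetCLM (k : Fin m) : (Fin m → ℝ) →L[ℝ] ({i : Fin m // i ≠ k} → ℝ) :=
  ContinuousLinearMap.pi fun i => ContinuousLinearMap.proj i.1

@[simp]
lemma forgetCLM_apply (k : Fin m) (u : Fin m → ℝ) (i : {i : Fin m // i ≠ k}) :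
    forgetCLM k u i = u i.1 := rfl

@[simp]
lemma extendCLM_self (k : Fin m) (w : {i : Fin m // i ≠ k} → ℝ) : extendCLM k w k = 0 := by
  simp [extendCLM]

lemma extendCLM_of_ne {k i : Fin m} (h : i ≠ k) (w : {i : Fin m // i ≠ k} → ℝ) :
    extendCLM k w i = w ⟨i, h⟩ := by
  simp [extendCLM, h]

lemma extendCLM_eq_extendZero (k : Fin m) (w : {i : Fin m // i ≠ k} → ℝ) :
    extendCLM k w = extendZero k w := by
  ext i
  by_cases h : i = k
  · subst h; simp [extendZero]
  · simp [extendZero, extendCLM_of_ne h, h]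

@[simp]
lemma forgetCLM_extendCLM (k : Fin m) (w : {i : Fin m // i ≠ k} → ℝ) :
    forgetCLM k (extendCLM k w) = w := by
  ext i
  simp [extendCLM_of_ne i.2]

lemma extendCLM_forgetCLM_add (k : Fin m) (u : Fin m → ℝ) :
    extendCLM k (forgetCLM k u) + u k • Pi.single k (1 : ℝ) = u := by
  ext i
  by_cases h : i = k
  · subst h; simp
  · simp [extendCLM_of_ne h, h]

end Linear

/-- A control affine system `y' = f₀ y + ∑ⱼ uⱼ fⱼ y` on an open subset `D` of a vector space, with
a map `ψ` whose components are first integrals of `f k`. -/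
structure LocalSystem (E : Type*) [NormedAddCommGroup E] [NormedSpace ℝ E] (m : ℕ) where
  /-- The drift. -/
  f₀ : E → E
  /-- The control vector fields. -/
  f : Fin m → E → E
  /-- The index of the control field whose first integrals are considered. -/
  k : Fin m
  /-- The first integrals. -/
  ψ : E → Fin m → ℝ
  /-- The domain. -/
  D : Set E
  isOpen_D : IsOpen D
  contDiffOn_f₀ : ContDiffOn ℝ ∞ f₀ D
  contDiffOn_f : ∀ j, ContDiffOn ℝ ∞ (f j) D
  contDiffOn_ψ : ContDiffOn ℝ ∞ ψ D
  fderiv_ψ_f : ∀ y ∈ D, fderiv ℝ ψ y (f k y) = 0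

namespace LocalSystem

variable {E : Type*} [NormedAddCommGroup E] [NormedSpace ℝ E] {m : ℕ} (s : LocalSystem E m)

/-- The controls other than the `k`-th one. -/
abbrev Red : Type := {i : Fin m // i ≠ s.k} → ℝ

/-- The dynamics. -/
def g (y : E) (u : Fin m → ℝ) : E := s.f₀ y + ∑ j, u j • s.f j y

/-- The first derivative of `z = ψ y` along the system. -/
def zd (q : E × (Fin m → ℝ)) : Fin m → ℝ := fderiv ℝ s.ψ q.1 (s.g q.1 q.2)

/-- The second derivative of `z = ψ y` along the system. -/
def zdd (q : E × (Fin m → ℝ)) (w : Fin m → ℝ) : Fin m → ℝ := fderiv ℝ s.zd q (s.g q.1 q.2, w)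

/-- The map `(y, (uᵢ)_{i ≠ k}) ↦ (z, z')`. -/
def F (p : E × s.Red) : (Fin m → ℝ) × (Fin m → ℝ) := (s.ψ p.1, s.zd (p.1, extendCLM s.k p.2))

lemma contDiffOn_g : ContDiffOn ℝ ∞ (fun q : E × (Fin m → ℝ) => s.g q.1 q.2) (s.D ×ˢ Set.univ) := by
  have hm : Set.MapsTo (Prod.fst : E × (Fin m → ℝ) → E) (s.D ×ˢ Set.univ) s.D := fun q hq => hq.1
  refine (s.contDiffOn_f₀.comp contDiffOn_fst hm).add (ContDiffOn.sum fun j _ => ?_)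
  refine ContDiffOn.smul ?_ ((s.contDiffOn_f j).comp contDiffOn_fst hm)
  exact (contDiff_apply ℝ ℝ j).comp_contDiffOn contDiffOn_snd

lemma contDiffOn_zd : ContDiffOn ℝ ∞ s.zd (s.D ×ˢ Set.univ) := by
  have hm : Set.MapsTo (Prod.fst : E × (Fin m → ℝ) → E) (s.D ×ˢ Set.univ) s.D := fun q hq => hq.1
  exact ((s.contDiffOn_ψ.fderiv_of_isOpen s.isOpen_D (m := ∞) (by simp)).comp contDiffOn_fst
    hm).clm_apply s.contDiffOn_g

lemma isOpen_prod {V : Type*} [TopologicalSpace V] : IsOpen (s.D ×ˢ (Set.univ : Set V)) :=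
  s.isOpen_D.prod isOpen_univ

lemma contDiffOn_F : ContDiffOn ℝ ∞ s.F (s.D ×ˢ Set.univ) := by
  refine ContDiffOn.prodMk (s.contDiffOn_ψ.comp contDiffOn_fst fun q hq => hq.1) ?_
  refine s.contDiffOn_zd.comp (t := s.D ×ˢ Set.univ) (ContDiff.contDiffOn ?_)
    fun q hq => ⟨hq.1, trivial⟩
  fun_prop

lemma g_add_smul_single (y : E) (u : Fin m → ℝ) (c : ℝ) :
    s.g y (u + c • Pi.single s.k (1 : ℝ)) = s.g y u + c • s.f s.k y := by
  simp only [g, Pi.add_apply, Pi.smul_apply, smul_eq_mul, add_smul, Finset.sum_add_distrib,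
    add_assoc]
  congr 2
  rw [Finset.sum_eq_single s.k]
  · simp
  · intro j _ hj; simp [hj]
  · simp

/-- `z'` does not depend on `u_k`, because `ψ` is a first integral of `f k`. -/
lemma zd_eq_F_snd {q : E × (Fin m → ℝ)} (hq : q.1 ∈ s.D) :
    s.zd q = (s.F (q.1, forgetCLM s.k q.2)).2 := by
  have h := s.g_add_smul_single q.1 (extendCLM s.k (forgetCLM s.k q.2)) (q.2 s.k)
  rw [extendCLM_forgetCLM_add] at h
  simp [zd, F, h, s.fderiv_ψ_f _ hq]

lemma contDiffAt_F {p : E × s.Red} (hp : p.1 ∈ s.D) : ContDiffAt ℝ ∞ s.F p :=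
  s.contDiffOn_F.contDiffAt (s.isOpen_prod.mem_nhds ⟨hp, trivial⟩)

lemma differentiableAt_F {p : E × s.Red} (hp : p.1 ∈ s.D) : DifferentiableAt ℝ s.F p :=
  (s.contDiffAt_F hp).differentiableAt (by simp)

lemma differentiableAt_ψ {y : E} (hy : y ∈ s.D) : DifferentiableAt ℝ s.ψ y :=
  (s.contDiffOn_ψ.contDiffAt (s.isOpen_D.mem_nhds hy)).differentiableAt (by simp)

lemma differentiableAt_zd {q : E × (Fin m → ℝ)} (hq : q.1 ∈ s.D) : DifferentiableAt ℝ s.zd q :=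
  (s.contDiffOn_zd.contDiffAt (s.isOpen_prod.mem_nhds ⟨hq, trivial⟩)).differentiableAt (by simp)

lemma fderiv_F_fst {p : E × s.Red} (hp : p.1 ∈ s.D) (v : E × s.Red) :
    (fderiv ℝ s.F p v).1 = fderiv ℝ s.ψ p.1 v.1 := by
  have h1 : HasFDerivAt (fun p => (s.F p).1)
      ((ContinuousLinearMap.fst ℝ _ _).comp (fderiv ℝ s.F p)) p :=
    (s.differentiableAt_F hp).hasFDerivAt.fst
  have h2 : HasFDerivAt (fun p : E × s.Red => s.ψ p.1)
      ((fderiv ℝ s.ψ p.1).comp (ContinuousLinearMap.fst ℝ E s.Red)) p :=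
    (s.differentiableAt_ψ hp).hasFDerivAt.comp p hasFDerivAt_fst
  exact congrArg (fun L => L v) (h1.unique h2)

/-- The differential of `z'` factors through the reduced variables. -/
lemma fderiv_zd {q : E × (Fin m → ℝ)} (hq : q.1 ∈ s.D) (v : E × (Fin m → ℝ)) :
    fderiv ℝ s.zd q v =
      (fderiv ℝ s.F (q.1, forgetCLM s.k q.2) (v.1, forgetCLM s.k v.2)).2 := by
  have h1 : HasFDerivAt (fun q : E × (Fin m → ℝ) => s.F (q.1, forgetCLM s.k q.2))
      ((fderiv ℝ s.F (q.1, forgetCLM s.k q.2)).comp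
        ((ContinuousLinearMap.id ℝ E).prodMap (forgetCLM s.k))) q :=
    HasFDerivAt.comp (f := fun q : E × (Fin m → ℝ) => (q.1, forgetCLM s.k q.2)) q
      (s.differentiableAt_F (p := (q.1, forgetCLM s.k q.2)) hq).hasFDerivAt
      ((ContinuousLinearMap.id ℝ E).prodMap (forgetCLM s.k)).hasFDerivAt
  have h2 : s.zd =ᶠ[𝓝 q] fun q => (s.F (q.1, forgetCLM s.k q.2)).2 := by
    filter_upwards [s.isOpen_prod.mem_nhds (⟨hq, trivial⟩ : q ∈ s.D ×ˢ Set.univ)] with q' hq'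
    exact s.zd_eq_F_snd hq'.1
  rw [h2.fderiv_eq, h1.snd.fderiv]
  rfl

/-- Along `(g, w)`, the map `(z, z')` has derivative `(z', z'')`. -/
lemma fderiv_F_g {q : E × (Fin m → ℝ)} (hq : q.1 ∈ s.D) (w : Fin m → ℝ) :
    fderiv ℝ s.F (q.1, forgetCLM s.k q.2) (s.g q.1 q.2, forgetCLM s.k w) =
      (s.zd q, s.zdd q w) := by
  refine Prod.ext (s.fderiv_F_fst (p := (q.1, forgetCLM s.k q.2)) hq _) ?_
  exact (s.fderiv_zd hq (s.g q.1 q.2, w)).symm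

lemma zdd_congr {q : E × (Fin m → ℝ)} (hq : q.1 ∈ s.D) {w w' : Fin m → ℝ}
    (h : forgetCLM s.k w = forgetCLM s.k w') : s.zdd q w = s.zdd q w' := by
  have h1 := s.fderiv_F_g hq w
  rw [h, s.fderiv_F_g hq w'] at h1
  exact (congrArg Prod.snd h1).symm

lemma fderiv_F_control {p : E × s.Red} (hp : p.1 ∈ s.D) (b : s.Red) :
    (fderiv ℝ s.F p (0, b)).2 =
      fderiv ℝ s.ψ p.1 (∑ j, extendCLM s.k b j • s.f j p.1) := by
  have h1 : HasFDerivAt (fun b' : s.Red => (s.F (p.1, b')).2)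
      ((ContinuousLinearMap.snd ℝ _ _).comp ((fderiv ℝ s.F p).comp
        (ContinuousLinearMap.inr ℝ E s.Red))) p.2 :=
    (HasFDerivAt.comp (f := fun b' : s.Red => (p.1, b')) p.2 (s.differentiableAt_F hp).hasFDerivAt
      (hasFDerivAt_prodMk_right p.1 p.2)).snd
  have h2 : HasFDerivAt (fun b' : s.Red => (s.F (p.1, b')).2)
      ((fderiv ℝ s.ψ p.1).comp (∑ j, ((ContinuousLinearMap.proj j).comp
        (extendCLM s.k)).smulRight (s.f j p.1))) p.2 := by
    refine (fderiv ℝ s.ψ p.1).hasFDerivAt.comp p.2 ?_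
    refine HasFDerivAt.const_add (s.f₀ p.1) (HasFDerivAt.fun_sum fun j _ => ?_)
    exact HasFDerivAt.smul_const (c := fun b' : s.Red => extendCLM s.k b' j)
      ((ContinuousLinearMap.proj (R := ℝ) (φ := fun _ => ℝ) j).comp
        (extendCLM s.k)).hasFDerivAt (s.f j p.1)
  have h3 := congrArg (fun L => L b) (h1.unique h2)
  simpa using h3

/-- `L_{f_k} L_g ψ = - dψ [g, f_k]`, because `L_{f_k} ψ = 0`. -/
lemma fderiv_zd_f {y : E} (hy : y ∈ s.D) (u : Fin m → ℝ) :
    fderiv ℝ s.zd (y, u) (s.f s.k y, 0) =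
      - fderiv ℝ s.ψ y (VectorField.lieBracket ℝ (fun y => s.g y u) (s.f s.k) y) := by
  have hD := s.isOpen_D.mem_nhds hy
  have hψ : ContDiffAt ℝ ∞ s.ψ y := s.contDiffOn_ψ.contDiffAt hD
  have hψ' : DifferentiableAt ℝ (fderiv ℝ s.ψ) y :=
    (hψ.fderiv_right (m := 1) (by norm_cast)).differentiableAt (by simp)
  have hf : DifferentiableAt ℝ (s.f s.k) y :=
    ((s.contDiffOn_f s.k).contDiffAt hD).differentiableAt (by simp)
  have hg : DifferentiableAt ℝ (fun y => s.g y u) y := by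
    have h := (s.contDiffOn_g.contDiffAt (x := (y, u))
      (s.isOpen_prod.mem_nhds ⟨hy, trivial⟩)).differentiableAt (by simp)
    exact DifferentiableAt.comp (f := fun y => (y, u)) y h
      (hasFDerivAt_prodMk_left y u).differentiableAt
  have h0 : fderiv ℝ (fun y => fderiv ℝ s.ψ y (s.f s.k y)) y = 0 := by
    have : (fun y => fderiv ℝ s.ψ y (s.f s.k y)) =ᶠ[𝓝 y] fun _ => 0 := by
      filter_upwards [hD] with y' hy' using s.fderiv_ψ_f y' hy'
    rw [this.fderiv_eq, fderiv_fun_const]; rfl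
  -- `L_g L_{f_k} ψ = 0`, expanded.
  have h1 := congrArg (fun L => L (s.g y u)) (fderiv_clm_apply hψ' hf ▸ h0)
  have h2 : fderiv ℝ s.zd (y, u) (s.f s.k y, 0) =
      fderiv ℝ (fun y => fderiv ℝ s.ψ y (s.g y u)) y (s.f s.k y) := by
    have h := HasFDerivAt.comp (f := fun y => (y, u)) y
      (s.differentiableAt_zd (q := (y, u)) hy).hasFDerivAt
      (hasFDerivAt_prodMk_left y u)
    have h' : fderiv ℝ (fun y => fderiv ℝ s.ψ y (s.g y u)) y = _ := h.fderiv
    rw [h']; simp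
  have h2n : minSmoothness ℝ 2 ≤ ∞ := by
    rw [minSmoothness_of_isRCLikeNormedField]
    exact WithTop.coe_le_coe.2 (le_top : (2 : ℕ∞) ≤ ⊤)
  have hsymm := hψ.isSymmSndFDerivAt h2n (s.g y u) (s.f s.k y)
  rw [h2, fderiv_clm_apply hψ' hg, VectorField.lieBracket_eq]
  simp only [add_apply, ContinuousLinearMap.comp_apply,
    ContinuousLinearMap.flip_apply, zero_apply, map_sub] at h1 ⊢
  rw [hsymm] at h1
  linear_combination (exp := 1) h1

end LocalSystem

/-! ### The local inverse of `(y, (uᵢ)_{i ≠ k}) ↦ (z, z')` -/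

namespace LocalSystem

variable {E : Type*} [NormedAddCommGroup E] [NormedSpace ℝ E] {m : ℕ}

/-- A local inverse of `(y, (uᵢ)_{i ≠ k}) ↦ (z, z')`, with a linear form `ℓ` that does not vanish
on `f k` and serves to solve for the `k`-th control. -/
structure ReducedChart (s : LocalSystem E m) where
  /-- The map `F` on an open set where it is a diffeomorphism. -/
  e : OpenPartialHomeomorph (E × s.Red) ((Fin m → ℝ) × (Fin m → ℝ))
  coe_e : ∀ p, e p = s.F p
  contDiffOn_symm : ContDiffOn ℝ ∞ e.symm e.target
  mem_D : ∀ p ∈ e.source, p.1 ∈ s.D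
  /-- A linear form that does not vanish on `f k`. -/
  ℓ : E →L[ℝ] ℝ
  ℓ_ne_zero : ∀ p ∈ e.source, ℓ (s.f s.k p.1) ≠ 0

variable (s : LocalSystem E m)

lemma finrank_prod_red [FiniteDimensional ℝ E] (hE : Module.finrank ℝ E = m + 1) :
    Module.finrank ℝ (E × s.Red) = Module.finrank ℝ ((Fin m → ℝ) × (Fin m → ℝ)) := by
  have hm : 0 < m := s.k.pos
  have : Fintype.card {i : Fin m // i ≠ s.k} = m - 1 := by
    rw [Fintype.card_subtype_compl]; simp
  rw [Module.finrank_prod, Module.finrank_prod, hE, Module.finrank_fintype_fun_eq_card,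
    Module.finrank_fin_fun, this]
  omega

/-- The kernel of a surjective `dψ` is the line spanned by `f k`. -/
lemma exists_eq_smul_of_fderiv_ψ_eq_zero [FiniteDimensional ℝ E]
    (hE : Module.finrank ℝ E = m + 1) {y : E} (hy : y ∈ s.D)
    (hsurj : Function.Surjective (fderiv ℝ s.ψ y)) (hne : s.f s.k y ≠ 0) {a : E}
    (ha : fderiv ℝ s.ψ y a = 0) : ∃ c : ℝ, a = c • s.f s.k y := by
  have h1 := LinearMap.finrank_range_add_finrank_ker (fderiv ℝ s.ψ y).toLinearMap
  rw [LinearMap.range_eq_top.2 hsurj, finrank_top, Module.finrank_fin_fun, hE] at h1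
  have h2 : Module.finrank ℝ (fderiv ℝ s.ψ y).toLinearMap.ker = 1 := by omega
  have h3 := (finrank_eq_one_iff_of_nonzero'
    (⟨s.f s.k y, s.fderiv_ψ_f y hy⟩ : (fderiv ℝ s.ψ y).toLinearMap.ker)
    (fun h => hne (congrArg Subtype.val h))).1 h2 ⟨a, ha⟩
  obtain ⟨c, hc⟩ := h3
  exact ⟨c, (congrArg Subtype.val hc).symm⟩

/-- The spanning condition makes the differential of `(z, z')` injective: `dψ` kills only `f k`,
and `dψ` maps the `f j`, `j ≠ k`, and `[g, f k]` to independent vectors. -/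
lemma fderiv_F_injective [FiniteDimensional ℝ E]
    (hE : Module.finrank ℝ E = m + 1) {y : E} (hy : y ∈ s.D) (u : Fin m → ℝ)
    (hspan : Submodule.span ℝ (Set.range (fun j => s.f j y) ∪
      {VectorField.lieBracket ℝ (fun y => s.g y u) (s.f s.k) y}) = ⊤)
    (hsurj : Function.Surjective (fderiv ℝ s.ψ y)) :
    s.f s.k y ≠ 0 ∧ Function.Injective (fderiv ℝ s.F (y, forgetCLM s.k u)) := by
  set br := VectorField.lieBracket ℝ (fun y => s.g y u) (s.f s.k) y with hbr
  -- The `m + 1` vectors of the spanning condition, the bracket being indexed by `none`.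
  let v : Option (Fin m) → E := fun o => o.elim br fun j => s.f j y
  have hv : LinearIndependent ℝ v := by
    apply linearIndependent_of_top_le_span_of_card_eq_finrank
    · rw [← hspan]
      apply Submodule.span_mono
      rintro _ (⟨j, rfl⟩ | rfl)
      · exact ⟨some j, rfl⟩
      · exact ⟨none, rfl⟩
    · simp [hE]
  have hne : s.f s.k y ≠ 0 := hv.ne_zero (some s.k)
  refine ⟨hne, ?_⟩
  rw [injective_iff_map_eq_zero]
  rintro ⟨a, b⟩ hab
  have h1 : fderiv ℝ s.ψ y a = 0 := by
    rw [← s.fderiv_F_fst (p := (y, forgetCLM s.k u)) hy (a, b), hab]; rfl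
  obtain ⟨c, rfl⟩ := s.exists_eq_smul_of_fderiv_ψ_eq_zero hE hy hsurj hne h1
  have h2 : (c • s.f s.k y, b) = c • ((s.f s.k y, 0) : E × s.Red) + (0, b) := by simp
  have h3 := congrArg Prod.snd hab
  have h4 := s.fderiv_zd (q := (y, u)) hy (s.f s.k y, 0)
  rw [s.fderiv_zd_f hy u, map_zero] at h4
  rw [h2, map_add, map_smul, Prod.snd_add, Prod.smul_snd, ← h4,
    s.fderiv_F_control (p := (y, forgetCLM s.k u)) hy b, Prod.snd_zero, smul_neg, ← map_smul,
    ← map_neg, ← map_add] at h3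
  obtain ⟨d, hd⟩ := s.exists_eq_smul_of_fderiv_ψ_eq_zero hE hy hsurj hne h3
  rw [Fintype.linearIndependent_iff] at hv
  -- `-c [g, f k] + ∑ bⱼ f j = d f k` is a linear relation between the vectors of the family.
  have h5 := hv (fun o => o.elim (-c) fun j => extendCLM s.k b j - d * (Pi.single s.k 1 : _ → ℝ) j)
    (by
      have : ∑ j, (d * (Pi.single s.k 1 : Fin m → ℝ) j) • s.f j y = d • s.f s.k y := by
        rw [Finset.sum_eq_single s.k]
        · simp
        · intro j _ hj; simp [hj]
        · simp
      rw [Fintype.sum_option]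
      simp only [Option.elim, v, sub_smul, Finset.sum_sub_distrib]
      rw [this, ← hd, ← hbr]
      simp)
  have hc : c = 0 := by simpa using h5 none
  have hb : b = 0 := by
    ext i
    simpa [extendCLM_of_ne i.2, Pi.single_apply, i.2] using h5 (some i.1)
  simp [hc, hb]

/-- Under the spanning condition, `(y, (uᵢ)_{i ≠ k}) ↦ (z, z')` has a local inverse. -/
theorem exists_reducedChart [FiniteDimensional ℝ E]
    (hE : Module.finrank ℝ E = m + 1) {y : E} (hy : y ∈ s.D) (u : Fin m → ℝ)
    (hspan : Submodule.span ℝ (Set.range (fun j => s.f j y) ∪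
      {VectorField.lieBracket ℝ (fun y => s.g y u) (s.f s.k) y}) = ⊤)
    (hsurj : Function.Surjective (fderiv ℝ s.ψ y)) :
    ∃ r : s.ReducedChart, (y, forgetCLM s.k u) ∈ r.e.source := by
  obtain ⟨hne, hinj⟩ := s.fderiv_F_injective hE hy u hspan hsurj
  set p₀ : E × s.Red := (y, forgetCLM s.k u) with hp₀
  have hF : ContDiffAt ℝ ∞ s.F p₀ := s.contDiffAt_F hy
  let L : (E × s.Red) ≃L[ℝ] ((Fin m → ℝ) × (Fin m → ℝ)) :=
    (LinearEquiv.ofInjectiveOfFinrankEq (fderiv ℝ s.F p₀).toLinearMap hinj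
      (s.finrank_prod_red hE)).toContinuousLinearEquiv
  have hL : (L : (E × s.Red) →L[ℝ] _) = fderiv ℝ s.F p₀ := by
    ext v <;> rfl
  have hF' : HasFDerivAt s.F (L : (E × s.Red) →L[ℝ] _) p₀ :=
    hL ▸ (s.differentiableAt_F hy).hasFDerivAt
  obtain ⟨ℓ, -, hℓ⟩ := exists_dual_vector ℝ (s.f s.k y) (norm_ne_zero_iff.2 hne)
  let e₀ := hF.toOpenPartialHomeomorph s.F hF' (by simp)
  -- On `A` the differential of `F` is invertible and `ℓ (f k)` does not vanish.
  let A : Set (E × s.Red) := (s.D ×ˢ Set.univ) ∩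
    (fun p => (fderiv ℝ s.F p, ℓ (s.f s.k p.1))) ⁻¹'
      (Set.range ((↑) : ((E × s.Red) ≃L[ℝ] ((Fin m → ℝ) × (Fin m → ℝ))) → _) ×ˢ {0}ᶜ)
  have hA : IsOpen A := by
    refine ContinuousOn.isOpen_inter_preimage (ContinuousOn.prodMk ?_ ?_) s.isOpen_prod
      (ContinuousLinearEquiv.isOpen.prod isOpen_compl_singleton)
    · exact s.contDiffOn_F.continuousOn_fderiv_of_isOpen s.isOpen_prod (by simp)
    · exact ℓ.continuous.comp_continuousOn ((s.contDiffOn_f s.k).continuousOn.comp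
        continuousOn_fst fun p hp => hp.1)
  have hpA : p₀ ∈ A := ⟨⟨hy, trivial⟩, ⟨L, hL⟩, by simpa [hp₀, hℓ] using hne⟩
  refine ⟨⟨e₀.restrOpen A hA, fun p => rfl, fun Z hZ => ?_, fun p hp => hp.2.1.1, ℓ,
    fun p hp => hp.2.2.2⟩, ⟨hF.mem_toOpenPartialHomeomorph_source hF' (by simp), hpA⟩⟩
  have hp := (e₀.restrOpen A hA).map_target hZ
  obtain ⟨L', hL'⟩ := hp.2.2.1
  refine ((e₀.restrOpen A hA).contDiffAt_symm (f₀' := L') hZ ?_ ?_).contDiffWithinAt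
  · rw [hL']
    exact (s.differentiableAt_F hp.2.1.1).hasFDerivAt
  · exact s.contDiffAt_F hp.2.1.1

end LocalSystem

/-! ### Solving for the state and the controls -/

namespace LocalSystem.ReducedChart

variable {E : Type*} [NormedAddCommGroup E] [NormedSpace ℝ E] {m : ℕ}
  {s : LocalSystem E m} (r : s.ReducedChart)

/-- The set of all `(y, u)` whose reduced part `(y, (uᵢ)_{i ≠ k})` lies in the domain of the
chart; the `k`-th control is unrestricted. -/
def W : Set (E × (Fin m → ℝ)) := {q | (q.1, forgetCLM s.k q.2) ∈ r.e.source}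

/-- The time derivative of `(y, (uᵢ)_{i ≠ k})` as a function of `Z = (z, z')` and `c = z''`. -/
def velocity (Z : (Fin m → ℝ) × (Fin m → ℝ)) (c : Fin m → ℝ) : E × s.Red :=
  fderiv ℝ r.e.symm Z (Z.2, c)

/-- The controls as a function of `Z = (z, z')` and `c = z''`: the `k`-th one is found by comparing
`y'` with `g y u` along `f k`. -/
def control (Z : (Fin m → ℝ) × (Fin m → ℝ)) (c : Fin m → ℝ) : Fin m → ℝ :=
  extendCLM s.k (r.e.symm Z).2 +
    (r.ℓ ((r.velocity Z c).1 - s.g (r.e.symm Z).1 (extendCLM s.k (r.e.symm Z).2)) /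
      r.ℓ (s.f s.k (r.e.symm Z).1)) • Pi.single s.k (1 : ℝ)

lemma isOpen_W : IsOpen r.W := by
  refine r.e.open_source.preimage ?_
  fun_prop

lemma mem_D_of_mem_W {q : E × (Fin m → ℝ)} (hq : q ∈ r.W) : q.1 ∈ s.D := r.mem_D _ hq

lemma F_mem_target {p : E × s.Red} (hp : p ∈ r.e.source) : s.F p ∈ r.e.target :=
  r.coe_e p ▸ r.e.map_source hp

lemma symm_F {p : E × s.Red} (hp : p ∈ r.e.source) : r.e.symm (s.F p) = p :=
  r.coe_e p ▸ r.e.left_inv hp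

lemma F_symm {Z : (Fin m → ℝ) × (Fin m → ℝ)} (hZ : Z ∈ r.e.target) : s.F (r.e.symm Z) = Z :=
  r.coe_e _ ▸ r.e.right_inv hZ

lemma differentiableAt_symm {Z : (Fin m → ℝ) × (Fin m → ℝ)} (hZ : Z ∈ r.e.target) :
    DifferentiableAt ℝ r.e.symm Z :=
  (r.contDiffOn_symm.contDiffAt (r.e.open_target.mem_nhds hZ)).differentiableAt (by simp)

lemma fderiv_symm_fderiv_F {p : E × s.Red} (hp : p ∈ r.e.source) (v : E × s.Red) :
    fderiv ℝ r.e.symm (s.F p) (fderiv ℝ s.F p v) = v := by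
  have h : HasFDerivAt (fun p => r.e.symm (s.F p)) _ p :=
    (r.differentiableAt_symm (r.F_mem_target hp)).hasFDerivAt.comp p
      (s.differentiableAt_F (r.mem_D p hp)).hasFDerivAt
  have h' : (fun p => r.e.symm (s.F p)) =ᶠ[𝓝 p] id := by
    filter_upwards [r.e.open_source.mem_nhds hp] with p' hp' using r.symm_F hp'
  exact congrArg (fun L => L v) (h.unique ((hasFDerivAt_id p).congr_of_eventuallyEq h'))

lemma fderiv_F_fderiv_symm {Z : (Fin m → ℝ) × (Fin m → ℝ)} (hZ : Z ∈ r.e.target)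
    (v : (Fin m → ℝ) × (Fin m → ℝ)) :
    fderiv ℝ s.F (r.e.symm Z) (fderiv ℝ r.e.symm Z v) = v := by
  have h : HasFDerivAt (fun Z => s.F (r.e.symm Z)) _ Z :=
    (s.differentiableAt_F (r.mem_D _ (r.e.map_target hZ))).hasFDerivAt.comp Z
      (r.differentiableAt_symm hZ).hasFDerivAt
  have h' : (fun Z => s.F (r.e.symm Z)) =ᶠ[𝓝 Z] id := by
    filter_upwards [r.e.open_target.mem_nhds hZ] with Z' hZ' using r.F_symm hZ'
  exact congrArg (fun L => L v) (h.unique ((hasFDerivAt_id Z).congr_of_eventuallyEq h'))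

lemma fderiv_ψ_surjective {p : E × s.Red} (hp : p ∈ r.e.source) :
    Function.Surjective (fderiv ℝ s.ψ p.1) := by
  intro c
  have h := r.fderiv_F_fderiv_symm (r.F_mem_target hp) (c, 0)
  rw [r.symm_F hp] at h
  exact ⟨_, (s.fderiv_F_fst (r.mem_D p hp) _).symm.trans (congrArg Prod.fst h)⟩

lemma eq_smul_of_fderiv_ψ_eq_zero [FiniteDimensional ℝ E] (hE : Module.finrank ℝ E = m + 1)
    {p : E × s.Red} (hp : p ∈ r.e.source) {a : E} (ha : fderiv ℝ s.ψ p.1 a = 0) :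
    a = (r.ℓ a / r.ℓ (s.f s.k p.1)) • s.f s.k p.1 := by
  have h0 := r.ℓ_ne_zero p hp
  obtain ⟨c, rfl⟩ := s.exists_eq_smul_of_fderiv_ψ_eq_zero hE (r.mem_D p hp)
    (r.fderiv_ψ_surjective hp) (fun h => h0 (by simp [h])) ha
  rw [map_smul, smul_eq_mul, mul_div_cancel_right₀ _ h0]

/-! The controls `u` recovered from `(z, z', z'')`, together with the state `y`, satisfy the
differential equation. -/

section Target

variable {Z : (Fin m → ℝ) × (Fin m → ℝ)} (hZ : Z ∈ r.e.target) (c : Fin m → ℝ)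

lemma forget_control : forgetCLM s.k (r.control Z c) = (r.e.symm Z).2 := by
  ext i
  have h : (Pi.single s.k (1 : ℝ) : Fin m → ℝ) i.1 = 0 := by simp [i.2]
  simp [control, extendCLM_of_ne i.2, h]

include hZ in
lemma mem_W_of_mem_target : ((r.e.symm Z).1, r.control Z c) ∈ r.W := by
  change (_, forgetCLM s.k (r.control Z c)) ∈ r.e.source
  rw [forget_control]
  exact r.e.map_target hZ

include hZ in
/-- The velocity of the state is given by the dynamics: both are mapped to `z'` by `dψ`, so they
differ by a multiple of `f k` for `u_k = 0`, and the choice of `u_k` removes the difference. -/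
lemma velocity_fst [FiniteDimensional ℝ E] (hE : Module.finrank ℝ E = m + 1) :
    (r.velocity Z c).1 = s.g (r.e.symm Z).1 (r.control Z c) := by
  have hp := r.e.map_target hZ
  have h1 : fderiv ℝ s.ψ (r.e.symm Z).1 (r.velocity Z c).1 = Z.2 := by
    rw [← s.fderiv_F_fst (r.mem_D _ hp), velocity, r.fderiv_F_fderiv_symm hZ]
  have h2 : fderiv ℝ s.ψ (r.e.symm Z).1
      (s.g (r.e.symm Z).1 (extendCLM s.k (r.e.symm Z).2)) = Z.2 :=
    congrArg Prod.snd (r.F_symm hZ)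
  have h3 := r.eq_smul_of_fderiv_ψ_eq_zero hE hp
    (a := (r.velocity Z c).1 - s.g (r.e.symm Z).1 (extendCLM s.k (r.e.symm Z).2))
    (by rw [map_sub, h1, h2, sub_self])
  rw [control, s.g_add_smul_single, ← h3]
  abel

include hZ in
lemma ψ_symm : s.ψ (r.e.symm Z).1 = Z.1 := congrArg Prod.fst (r.F_symm hZ)

include hZ in
lemma zd_control : s.zd ((r.e.symm Z).1, r.control Z c) = Z.2 := by
  rw [s.zd_eq_F_snd (r.mem_D_of_mem_W (r.mem_W_of_mem_target hZ c)), forget_control,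
    Prod.mk.eta, r.F_symm hZ]

include hZ in
lemma zdd_control [FiniteDimensional ℝ E] (hE : Module.finrank ℝ E = m + 1) {w : Fin m → ℝ}
    (hw : forgetCLM s.k w = (r.velocity Z c).2) :
    s.zdd ((r.e.symm Z).1, r.control Z c) w = c := by
  have h := s.fderiv_F_g (r.mem_D_of_mem_W (r.mem_W_of_mem_target hZ c)) w
  rw [hw, ← r.velocity_fst hZ c hE, forget_control, Prod.mk.eta, Prod.mk.eta, velocity,
    r.fderiv_F_fderiv_symm hZ] at h
  exact (congrArg Prod.snd h).symm

end Target

/-! Conversely, `(z, z', z'')` determines `(y, u)` and the derivatives of the reduced controls. -/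

section Source

variable {q : E × (Fin m → ℝ)} (hq : q ∈ r.W) (w : Fin m → ℝ)

include hq in
lemma ψ_zd_eq_F : (s.ψ q.1, s.zd q) = s.F (q.1, forgetCLM s.k q.2) :=
  Prod.ext rfl (s.zd_eq_F_snd (r.mem_D_of_mem_W hq))

include hq in
lemma ψ_zd_mem_target : (s.ψ q.1, s.zd q) ∈ r.e.target := by
  rw [r.ψ_zd_eq_F hq]
  exact r.F_mem_target hq

include hq in
lemma symm_ψ_zd : r.e.symm (s.ψ q.1, s.zd q) = (q.1, forgetCLM s.k q.2) := by
  rw [r.ψ_zd_eq_F hq]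
  exact r.symm_F hq

include hq in
lemma velocity_zdd :
    r.velocity (s.ψ q.1, s.zd q) (s.zdd q w) = (s.g q.1 q.2, forgetCLM s.k w) := by
  rw [velocity, r.ψ_zd_eq_F hq]
  have h := s.fderiv_F_g (r.mem_D_of_mem_W hq) w
  rw [s.zd_eq_F_snd (r.mem_D_of_mem_W hq)] at h
  rw [← h, r.fderiv_symm_fderiv_F hq]

include hq in
lemma control_zdd : r.control (s.ψ q.1, s.zd q) (s.zdd q w) = q.2 := by
  have h := s.g_add_smul_single q.1 (extendCLM s.k (forgetCLM s.k q.2)) (q.2 s.k)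
  rw [extendCLM_forgetCLM_add] at h
  rw [control, r.velocity_zdd hq, r.symm_ψ_zd hq]
  simp only [h, add_sub_cancel_left, map_smul, smul_eq_mul]
  rw [mul_div_cancel_right₀ _ (r.ℓ_ne_zero _ hq), extendCLM_forgetCLM_add]

end Source

/-! Smoothness of the recovered quantities. -/

lemma contDiffOn_symm_comp_fst {V : Type*} [NormedAddCommGroup V] [NormedSpace ℝ V] :
    ContDiffOn ℝ ∞ (fun t : ((Fin m → ℝ) × (Fin m → ℝ)) × V => r.e.symm t.1)
      (r.e.target ×ˢ Set.univ) :=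
  r.contDiffOn_symm.comp contDiffOn_fst fun _ ht => ht.1

lemma contDiffOn_velocity :
    ContDiffOn ℝ ∞ (fun t : ((Fin m → ℝ) × (Fin m → ℝ)) × (Fin m → ℝ) => r.velocity t.1 t.2)
      (r.e.target ×ˢ Set.univ) := by
  have h := r.contDiffOn_symm.fderiv_of_isOpen (m := ∞) r.e.open_target (by simp)
  refine (h.comp contDiffOn_fst fun t ht => ht.1).clm_apply (ContDiff.contDiffOn ?_)
  fun_prop

lemma contDiffOn_control :
    ContDiffOn ℝ ∞ (fun t : ((Fin m → ℝ) × (Fin m → ℝ)) × (Fin m → ℝ) => r.control t.1 t.2)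
      (r.e.target ×ˢ Set.univ) := by
  have hR := r.contDiffOn_symm_comp_fst (V := Fin m → ℝ)
  have hD : Set.MapsTo (fun t : ((Fin m → ℝ) × (Fin m → ℝ)) × (Fin m → ℝ) => (r.e.symm t.1).1)
      (r.e.target ×ˢ Set.univ) s.D := fun t ht => r.mem_D _ (r.e.map_target ht.1)
  have hx : ContDiffOn ℝ ∞
      (fun t : ((Fin m → ℝ) × (Fin m → ℝ)) × (Fin m → ℝ) => extendCLM s.k (r.e.symm t.1).2)
      (r.e.target ×ˢ Set.univ) := (extendCLM s.k).contDiff.comp_contDiffOn hR.snd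
  refine hx.add ?_
  refine ContDiffOn.smul_const ?_ _
  refine ContDiffOn.div ?_ ?_ ?_
  · refine r.ℓ.contDiff.comp_contDiffOn (r.contDiffOn_velocity.fst.sub ?_)
    exact s.contDiffOn_g.comp (hR.fst.prodMk hx) fun t ht => ⟨hD ht, trivial⟩
  · exact r.ℓ.contDiff.comp_contDiffOn ((s.contDiffOn_f s.k).comp hR.fst hD)
  · exact fun t ht => r.ℓ_ne_zero _ (r.e.map_target ht.1)

end LocalSystem.ReducedChart

/-! ### Functions of finitely many derivatives -/

lemma isOpenMap_trunc {X : Type*} [TopologicalSpace X] {m : ℕ} (N : ℕ) :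
    IsOpenMap (trunc N : X × Jets m → X × (Fin N → Fin m → ℝ)) := by
  -- The sections complete the truncated sequence by the remaining terms of a given one.
  refine IsOpenMap.of_sections fun x =>
    ⟨fun q => (q.1, fun j => if h : j < N then q.2 ⟨j, h⟩ else x.2 j), ?_, ?_, ?_⟩
  · refine Continuous.continuousAt (continuous_fst.prodMk (continuous_pi fun j => ?_))
    by_cases h : j < N
    · simp only [h, dite_true]; fun_prop
    · simp only [h, dite_false]; fun_prop
  · refine Prod.ext rfl (funext fun j => ?_)
    simp [trunc]
  · intro q
    refine Prod.ext rfl (funext fun j => ?_)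
    simp [trunc]

section Calculus

variable {A V : Type*} [NormedAddCommGroup A] [NormedSpace ℝ A] [NormedAddCommGroup V]
  [NormedSpace ℝ V] {m : ℕ}

/-- A function on an infinite jet space over a vector space is smooth on `S` if it depends on
finitely many coordinates only, and smoothly so. -/
def JetSmoothOn (h : A × Jets m → V) (S : Set (A × Jets m)) : Prop :=
  ∃ (N : ℕ) (F : A × (Fin N → Fin m → ℝ) → V),
    ContDiffOn ℝ ∞ F (trunc N '' S) ∧ ∀ p ∈ S, h p = F (trunc N p)

/-- The Cartan field of the system `y' = γ y v`. -/
def cartanField (γ : A → (Fin m → ℝ) → A) (p : A × Jets m) : A × Jets m :=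
  (γ p.1 (p.2 0), fun j => p.2 (j + 1))

/-- The derivative of `h` along the Cartan field of the system `y' = γ y v`. It is a line
derivative: the jet space has no norm, but smooth functions on it are differentiable along lines,
and the derivative depends only on `h`, not on its truncations. -/
def lieDeriv (γ : A → (Fin m → ℝ) → A) (h : A × Jets m → V) (p : A × Jets m) : V :=
  lineDeriv ℝ h p (cartanField γ p)

lemma eventually_add_smul_mem {S : Set (A × Jets m)} (hS : IsOpen S) {p : A × Jets m} (hp : p ∈ S)
    (v : A × Jets m) : ∀ᶠ t : ℝ in 𝓝 0, p + t • v ∈ S := by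
  have h : Continuous fun t : ℝ => p + t • v := by fun_prop
  exact h.continuousAt.preimage_mem_nhds (hS.mem_nhds (by simpa using hp))

lemma hasLineDerivAt_of_trunc {h : A × Jets m → V} {p : A × Jets m} {N : ℕ}
    {F : A × (Fin N → Fin m → ℝ) → V} {F' : A × (Fin N → Fin m → ℝ) →L[ℝ] V}
    (hF : ∀ᶠ q in 𝓝 p, h q = F (trunc N q)) (hF' : HasFDerivAt F F' (trunc N p))
    (v : A × Jets m) : HasLineDerivAt ℝ h (F' (trunc N v)) p v := by
  have h1 : HasLineDerivAt ℝ F (F' (trunc N v)) (trunc N p) (trunc N v) := hF'.hasLineDerivAt _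
  have h2 : Continuous fun t : ℝ => p + t • v := by fun_prop
  refine HasDerivAt.congr_of_eventuallyEq h1 ?_
  have h3 := h2.tendsto 0
  rw [zero_smul, add_zero] at h3
  filter_upwards [h3.eventually hF] with t ht
  exact ht

lemma hasLineDerivAt_fst (p v : A × Jets m) :
    HasLineDerivAt ℝ (fun q : A × Jets m => q.1) v.1 p v :=
  hasLineDerivAt_of_trunc (N := 0) (F := ContinuousLinearMap.fst ℝ A (Fin 0 → Fin m → ℝ))
    (Filter.Eventually.of_forall fun _ => rfl) (ContinuousLinearMap.hasFDerivAt _) v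

lemma hasLineDerivAt_snd_apply (j : ℕ) (p v : A × Jets m) :
    HasLineDerivAt ℝ (fun q : A × Jets m => q.2 j) (v.2 j) p v := by
  let L : A × (Fin (j + 1) → Fin m → ℝ) →L[ℝ] (Fin m → ℝ) :=
    (ContinuousLinearMap.proj (Fin.last j)).comp (ContinuousLinearMap.snd ℝ A _)
  exact hasLineDerivAt_of_trunc (F := L) (Filter.Eventually.of_forall fun _ => rfl)
    L.hasFDerivAt v

namespace JetSmoothOn

variable {h : A × Jets m → V} {S : Set (A × Jets m)}

lemma exists_hasFDerivAt (hh : JetSmoothOn h S) (hS : IsOpen S) {p : A × Jets m} (hp : p ∈ S) :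
    ∃ (N : ℕ) (F : A × (Fin N → Fin m → ℝ) → V) (F' : A × (Fin N → Fin m → ℝ) →L[ℝ] V),
      (∀ᶠ q in 𝓝 p, h q = F (trunc N q)) ∧ HasFDerivAt F F' (trunc N p) ∧
        ∀ v, F' (trunc N v) = lineDeriv ℝ h p v := by
  obtain ⟨N, F, hF, hhF⟩ := hh
  have h1 : ∀ᶠ q in 𝓝 p, h q = F (trunc N q) := by
    filter_upwards [hS.mem_nhds hp] with q hq using hhF q hq
  have h2 : HasFDerivAt F (fderiv ℝ F (trunc N p)) (trunc N p) :=
    ((hF.contDiffAt ((isOpenMap_trunc N S hS).mem_nhds ⟨p, hp, rfl⟩)).differentiableAt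
      (by simp)).hasFDerivAt
  exact ⟨N, F, _, h1, h2, fun v => (hasLineDerivAt_of_trunc h1 h2 v).lineDeriv.symm⟩

lemma hasLineDerivAt (hh : JetSmoothOn h S) (hS : IsOpen S) {p : A × Jets m} (hp : p ∈ S)
    (v : A × Jets m) : HasLineDerivAt ℝ h (lineDeriv ℝ h p v) p v := by
  obtain ⟨N, F, F', h1, h2, h3⟩ := hh.exists_hasFDerivAt hS hp
  exact h3 v ▸ hasLineDerivAt_of_trunc h1 h2 v

/-- Differentiation along the Cartan field preserves smoothness and raises the order by at most
one. -/
lemma lieDeriv (hh : JetSmoothOn h S) (hS : IsOpen S) {γ : A → (Fin m → ℝ) → A}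
    {G : Set (A × (Fin m → ℝ))} (hγ : ContDiffOn ℝ ∞ (fun q : A × (Fin m → ℝ) => γ q.1 q.2) G)
    (hSG : ∀ p ∈ S, (p.1, p.2 0) ∈ G) : JetSmoothOn (lieDeriv γ h) S := by
  obtain ⟨N, F, hF, hhF⟩ := hh
  have hT : IsOpen (trunc N '' S) := isOpenMap_trunc N S hS
  refine ⟨N + 1, fun q => fderiv ℝ F (q.1, fun j => q.2 j.castSucc)
    (γ q.1 (q.2 0), fun j => q.2 j.succ), ?_, fun p hp => ?_⟩
  · refine ContDiffOn.clm_apply ?_ (ContDiffOn.prodMk ?_ (ContDiff.contDiffOn ?_))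
    · refine (hF.fderiv_of_isOpen hT (m := ∞) (by simp)).comp
        (f := fun q : A × (Fin (N + 1) → Fin m → ℝ) => (q.1, fun j : Fin N => q.2 j.castSucc))
        (ContDiff.contDiffOn (by fun_prop)) ?_
      rintro _ ⟨p, hp, rfl⟩
      exact ⟨p, hp, rfl⟩
    · refine hγ.comp (f := fun q : A × (Fin (N + 1) → Fin m → ℝ) => (q.1, q.2 0))
        (ContDiff.contDiffOn (by fun_prop)) ?_
      rintro _ ⟨p, hp, rfl⟩
      exact hSG p hp
    · fun_prop
  · have h1 : ∀ᶠ q in 𝓝 p, h q = F (trunc N q) := by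
      filter_upwards [hS.mem_nhds hp] with q hq using hhF q hq
    have h2 : HasFDerivAt F (fderiv ℝ F (trunc N p)) (trunc N p) :=
      ((hF.contDiffAt (hT.mem_nhds ⟨p, hp, rfl⟩)).differentiableAt (by simp)).hasFDerivAt
    exact (hasLineDerivAt_of_trunc h1 h2 _).lineDeriv

lemma iterate_lieDeriv (hh : JetSmoothOn h S) (hS : IsOpen S) {γ : A → (Fin m → ℝ) → A}
    {G : Set (A × (Fin m → ℝ))} (hγ : ContDiffOn ℝ ∞ (fun q : A × (Fin m → ℝ) => γ q.1 q.2) G)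
    (hSG : ∀ p ∈ S, (p.1, p.2 0) ∈ G) (j : ℕ) :
    JetSmoothOn ((FlatSystems.lieDeriv γ)^[j] h) S := by
  induction j with
  | zero => exact hh
  | succ j ih =>
    rw [Function.iterate_succ_apply']
    exact ih.lieDeriv hS hγ hSG

/-- Chain rule: only the line derivatives of the components of the inner map enter. -/
lemma hasLineDerivAt_comp {B : Type*} [NormedAddCommGroup B] [NormedSpace ℝ B] {μ : ℕ}
    {h : B × Jets μ → V} {T : Set (B × Jets μ)} (hh : JetSmoothOn h T) (hT : IsOpen T)
    (hS : IsOpen S) {Ψ : A × Jets m → B × Jets μ} (hΨ : Set.MapsTo Ψ S T) {p : A × Jets m}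
    (hp : p ∈ S) {v : A × Jets m} {w : B × Jets μ}
    (h1 : HasLineDerivAt ℝ (fun q => (Ψ q).1) w.1 p v)
    (h2 : ∀ j, HasLineDerivAt ℝ (fun q => (Ψ q).2 j) (w.2 j) p v) :
    HasLineDerivAt ℝ (fun q => h (Ψ q)) (lineDeriv ℝ h (Ψ p) w) p v := by
  obtain ⟨N, F, hF, hhF⟩ := hh
  have h3 : ∀ᶠ q in 𝓝 (Ψ p), h q = F (trunc N q) := by
    filter_upwards [hT.mem_nhds (hΨ hp)] with q hq using hhF q hq
  have h4 : HasFDerivAt F (fderiv ℝ F (trunc N (Ψ p))) (trunc N (Ψ p)) :=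
    ((hF.contDiffAt ((isOpenMap_trunc N T hT).mem_nhds ⟨Ψ p, hΨ hp, rfl⟩)).differentiableAt
      (by simp)).hasFDerivAt
  rw [(hasLineDerivAt_of_trunc h3 h4 w).lineDeriv]
  have h5 : HasDerivAt (fun t : ℝ => trunc N (Ψ (p + t • v))) (trunc N w) 0 :=
    HasDerivAt.prodMk h1 (hasDerivAt_pi.2 fun j => h2 j)
  have h6 : HasFDerivAt F (fderiv ℝ F (trunc N (Ψ p))) (trunc N (Ψ (p + (0 : ℝ) • v))) := by
    simpa using h4
  refine HasDerivAt.congr_of_eventuallyEq (h6.comp_hasDerivAt (0 : ℝ) h5) ?_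
  filter_upwards [eventually_add_smul_mem hS hp v] with t ht
  exact hhF _ (hΨ ht)

end JetSmoothOn

end Calculus

/-! ### The Lie-Bäcklund isomorphism in coordinates -/

namespace LocalSystem.ReducedChart

variable {E : Type*} [NormedAddCommGroup E] [NormedSpace ℝ E] {m : ℕ}
  {s : LocalSystem E m} (r : s.ReducedChart)

/-- The set of all `(y, u, u', ...)` with `(y, u)` in the domain `W`. -/
def jetSource : Set (E × Jets m) := {p | (p.1, p.2 0) ∈ r.W}

/-- The set of all `(z, z', z'', ...)` with `(z, z')` in the image of the reduced chart. -/
def jetTarget : Set ((Fin m → ℝ) × Jets m) := {q | (q.1, q.2 0) ∈ r.e.target}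

/-- The `j`-th derivative of `z = ψ y` along the system. -/
def outputDeriv (_ : s.ReducedChart) (j : ℕ) : E × Jets m → Fin m → ℝ :=
  (lieDeriv s.g)^[j] fun p => s.ψ p.1

/-- The `j`-th derivative of the controls along the trivial system. -/
def controlDeriv (j : ℕ) : (Fin m → ℝ) × Jets m → Fin m → ℝ :=
  (lieDeriv fun _ v => v)^[j] fun q => r.control (q.1, q.2 0) (q.2 1)

/-- The map `(y, u, u', ...) ↦ (z, z', z'', ...)`. -/
def toTrivial (p : E × Jets m) : (Fin m → ℝ) × Jets m :=
  (s.ψ p.1, fun j => r.outputDeriv (j + 1) p)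

/-- The map `(z, z', z'', ...) ↦ (y, u, u', ...)`. -/
def ofTrivial (q : (Fin m → ℝ) × Jets m) : E × Jets m :=
  ((r.e.symm (q.1, q.2 0)).1, fun j => r.controlDeriv j q)

lemma isOpen_jetSource : IsOpen r.jetSource := r.isOpen_W.preimage (by fun_prop)

lemma isOpen_jetTarget : IsOpen r.jetTarget := r.e.open_target.preimage (by fun_prop)

lemma jetSmoothOn_ψ : JetSmoothOn (fun p : E × Jets m => s.ψ p.1) r.jetSource := by
  refine ⟨0, fun q => s.ψ q.1, s.contDiffOn_ψ.comp contDiffOn_fst ?_, fun _ _ => rfl⟩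
  rintro _ ⟨p, hp, rfl⟩
  exact r.mem_D_of_mem_W hp

lemma jetSmoothOn_outputDeriv (j : ℕ) : JetSmoothOn (r.outputDeriv j) r.jetSource :=
  r.jetSmoothOn_ψ.iterate_lieDeriv r.isOpen_jetSource s.contDiffOn_g
    (fun _ hp => ⟨r.mem_D_of_mem_W hp, trivial⟩) j

lemma jetSmoothOn_symm :
    JetSmoothOn (fun q : (Fin m → ℝ) × Jets m => r.e.symm (q.1, q.2 0)) r.jetTarget := by
  refine ⟨1, fun q => r.e.symm (q.1, q.2 0), r.contDiffOn_symm.comp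
    (ContDiff.contDiffOn (by fun_prop)) ?_, fun _ _ => rfl⟩
  rintro _ ⟨p, hp, rfl⟩
  exact hp

lemma jetSmoothOn_controlDeriv (j : ℕ) : JetSmoothOn (r.controlDeriv j) r.jetTarget := by
  refine JetSmoothOn.iterate_lieDeriv (G := Set.univ) ?_ r.isOpen_jetTarget
    contDiffOn_snd (fun _ _ => trivial) j
  refine ⟨2, fun q => r.control (q.1, q.2 0) (q.2 1), r.contDiffOn_control.comp
    (f := fun q : (Fin m → ℝ) × (Fin 2 → Fin m → ℝ) => ((q.1, q.2 0), q.2 1))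
    (ContDiff.contDiffOn (by fun_prop)) ?_, fun _ _ => rfl⟩
  rintro _ ⟨p, hp, rfl⟩
  exact ⟨hp, trivial⟩

lemma outputDeriv_succ (j : ℕ) : r.outputDeriv (j + 1) = lieDeriv s.g (r.outputDeriv j) :=
  Function.iterate_succ_apply' _ _ _

lemma controlDeriv_succ (j : ℕ) :
    r.controlDeriv (j + 1) = lieDeriv (fun _ v => v) (r.controlDeriv j) :=
  Function.iterate_succ_apply' _ _ _

lemma outputDeriv_one {p : E × Jets m} (hp : p ∈ r.jetSource) :
    r.outputDeriv 1 p = s.zd (p.1, p.2 0) := by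
  refine (hasLineDerivAt_of_trunc (N := 0) (F := fun q => s.ψ q.1)
    (F' := (fderiv ℝ s.ψ p.1).comp (ContinuousLinearMap.fst ℝ E _))
    (Filter.Eventually.of_forall fun _ => rfl) ?_ _).lineDeriv
  exact HasFDerivAt.comp (trunc 0 p) (s.differentiableAt_ψ (r.mem_D_of_mem_W hp)).hasFDerivAt
    hasFDerivAt_fst

lemma outputDeriv_two {p : E × Jets m} (hp : p ∈ r.jetSource) :
    r.outputDeriv 2 p = s.zdd (p.1, p.2 0) (p.2 1) := by
  rw [outputDeriv_succ]
  let L : E × (Fin 1 → Fin m → ℝ) →L[ℝ] E × (Fin m → ℝ) :=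
    (ContinuousLinearMap.id ℝ E).prodMap (ContinuousLinearMap.proj 0)
  refine (hasLineDerivAt_of_trunc (N := 1) (F := fun q => s.zd (L q))
    (F' := (fderiv ℝ s.zd (p.1, p.2 0)).comp L) ?_ ?_ _).lineDeriv
  · filter_upwards [r.isOpen_jetSource.mem_nhds hp] with q hq using r.outputDeriv_one hq
  · exact HasFDerivAt.comp (trunc 1 p) (s.differentiableAt_zd (q := L (trunc 1 p))
      (r.mem_D_of_mem_W hp)).hasFDerivAt L.hasFDerivAt

lemma mapsTo_toTrivial : Set.MapsTo r.toTrivial r.jetSource r.jetTarget := by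
  intro p hp
  change (s.ψ p.1, r.outputDeriv 1 p) ∈ r.e.target
  rw [r.outputDeriv_one hp]
  exact r.ψ_zd_mem_target hp

lemma mapsTo_ofTrivial : Set.MapsTo r.ofTrivial r.jetTarget r.jetSource := fun _ hq =>
  r.mem_W_of_mem_target hq _

/-- `ψ y` and its derivatives satisfy the trivial system along the given one, by definition. -/
lemma hasLineDerivAt_toTrivial {p : E × Jets m} (hp : p ∈ r.jetSource) :
    HasLineDerivAt ℝ (fun p => (r.toTrivial p).1)
        (cartanField (fun _ v => v) (r.toTrivial p)).1 p (cartanField s.g p) ∧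
      ∀ j, HasLineDerivAt ℝ (fun p => (r.toTrivial p).2 j)
        ((cartanField (fun _ v => v) (r.toTrivial p)).2 j) p (cartanField s.g p) := by
  refine ⟨r.jetSmoothOn_ψ.hasLineDerivAt r.isOpen_jetSource hp _, fun j => ?_⟩
  have h := (r.jetSmoothOn_outputDeriv (j + 1)).hasLineDerivAt r.isOpen_jetSource hp
    (cartanField s.g p)
  change HasLineDerivAt ℝ (r.outputDeriv (j + 1)) (r.outputDeriv (j + 1 + 1) p) p _
  rw [r.outputDeriv_succ (j + 1)]
  exact h

lemma lineDeriv_symm {q : (Fin m → ℝ) × Jets m} (hq : q ∈ r.jetTarget) :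
    lineDeriv ℝ (fun q : (Fin m → ℝ) × Jets m => r.e.symm (q.1, q.2 0)) q
      (cartanField (fun _ v => v) q) = r.velocity (q.1, q.2 0) (q.2 1) := by
  let L : (Fin m → ℝ) × (Fin 1 → Fin m → ℝ) →L[ℝ] (Fin m → ℝ) × (Fin m → ℝ) :=
    (ContinuousLinearMap.id ℝ (Fin m → ℝ)).prodMap (ContinuousLinearMap.proj 0)
  refine (hasLineDerivAt_of_trunc (N := 1) (F := fun q => r.e.symm (L q))
    (F' := (fderiv ℝ r.e.symm (q.1, q.2 0)).comp L)
    (Filter.Eventually.of_forall fun _ => rfl) ?_ _).lineDeriv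
  exact HasFDerivAt.comp (trunc 1 q) (r.differentiableAt_symm (Z := L (trunc 1 q))
    hq).hasFDerivAt L.hasFDerivAt

variable [FiniteDimensional ℝ E] (hE : Module.finrank ℝ E = m + 1)

include hE

/-- The state and the controls recovered from `(z, z', z'', ...)` satisfy the given system along
the trivial one. -/
lemma hasLineDerivAt_ofTrivial {q : (Fin m → ℝ) × Jets m} (hq : q ∈ r.jetTarget) :
    HasLineDerivAt ℝ (fun q => (r.ofTrivial q).1)
        (cartanField s.g (r.ofTrivial q)).1 q (cartanField (fun _ v => v) q) ∧
      ∀ j, HasLineDerivAt ℝ (fun q => (r.ofTrivial q).2 j)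
        ((cartanField s.g (r.ofTrivial q)).2 j) q (cartanField (fun _ v => v) q) := by
  refine ⟨?_, fun j => ?_⟩
  · have h := r.jetSmoothOn_symm.hasLineDerivAt r.isOpen_jetTarget hq
      (cartanField (fun _ v => v) q)
    rw [r.lineDeriv_symm hq] at h
    have h' := HasFDerivAt.comp_hasDerivAt (0 : ℝ)
      (ContinuousLinearMap.fst ℝ E s.Red).hasFDerivAt h
    change HasLineDerivAt ℝ (fun q => (r.ofTrivial q).1)
      (s.g (r.e.symm (q.1, q.2 0)).1 (r.control (q.1, q.2 0) (q.2 1))) q _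
    rw [← r.velocity_fst hq (q.2 1) hE]
    exact h'
  · have h := (r.jetSmoothOn_controlDeriv j).hasLineDerivAt r.isOpen_jetTarget hq
      (cartanField (fun _ v => v) q)
    change HasLineDerivAt ℝ (r.controlDeriv j) (r.controlDeriv (j + 1) q) q _
    rw [r.controlDeriv_succ j]
    exact h

omit [FiniteDimensional ℝ E] hE in
lemma controlDeriv_toTrivial (j : ℕ) :
    ∀ p ∈ r.jetSource, r.controlDeriv j (r.toTrivial p) = p.2 j := by
  induction j with
  | zero =>
    intro p hp
    change r.control (s.ψ p.1, r.outputDeriv 1 p) (r.outputDeriv 2 p) = p.2 0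
    rw [r.outputDeriv_one hp, r.outputDeriv_two hp]
    exact r.control_zdd hp _
  | succ j ih =>
    intro p hp
    have h := r.hasLineDerivAt_toTrivial hp
    have h1 := (r.jetSmoothOn_controlDeriv j).hasLineDerivAt_comp r.isOpen_jetTarget
      r.isOpen_jetSource r.mapsTo_toTrivial hp h.1 h.2
    -- By the induction hypothesis the composite is the coordinate `u^(j)`.
    have h2 : HasLineDerivAt ℝ (fun p : E × Jets m => p.2 j) (p.2 (j + 1)) p
        (cartanField s.g p) := hasLineDerivAt_snd_apply j _ _
    rw [controlDeriv_succ]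
    refine h1.unique (HasDerivAt.congr_of_eventuallyEq h2 ?_)
    filter_upwards [eventually_add_smul_mem r.isOpen_jetSource hp (cartanField s.g p)] with t ht
      using ih _ ht

lemma outputDeriv_ofTrivial (j : ℕ) :
    ∀ q ∈ r.jetTarget, r.outputDeriv (j + 1) (r.ofTrivial q) = q.2 j := by
  -- If the derivative of order `j` composed with `r.ofTrivial` is `c`, then the next one is the
  -- derivative of `c` along the trivial Cartan field.
  have key : ∀ (j : ℕ) (c : (Fin m → ℝ) × Jets m → Fin m → ℝ) (c' : Fin m → ℝ),
      (∀ q ∈ r.jetTarget, r.outputDeriv j (r.ofTrivial q) = c q) →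
      ∀ q ∈ r.jetTarget, HasLineDerivAt ℝ c c' q (cartanField (fun _ v => v) q) →
        r.outputDeriv (j + 1) (r.ofTrivial q) = c' := by
    intro j c c' hc q hq hcc
    have h := r.hasLineDerivAt_ofTrivial hE hq
    have h1 := (r.jetSmoothOn_outputDeriv j).hasLineDerivAt_comp r.isOpen_jetSource
      r.isOpen_jetTarget r.mapsTo_ofTrivial hq h.1 h.2
    rw [outputDeriv_succ]
    refine h1.unique (HasDerivAt.congr_of_eventuallyEq hcc ?_)
    filter_upwards [eventually_add_smul_mem r.isOpen_jetTarget hq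
      (cartanField (fun _ v => v) q)] with t ht using hc _ ht
  induction j with
  | zero =>
    intro q hq
    exact key 0 (fun q => q.1) _ (fun q hq => r.ψ_symm hq) q hq (hasLineDerivAt_fst _ _)
  | succ j ih =>
    intro q hq
    exact key (j + 1) (fun q => q.2 j) _ ih q hq (hasLineDerivAt_snd_apply j _ _)

/-- The two maps are inverse to each other: the base identities hold by construction, and the
higher ones follow by differentiating along the Cartan fields. -/
lemma invOn_toTrivial : Set.InvOn r.ofTrivial r.toTrivial r.jetSource r.jetTarget := by
  refine ⟨fun p hp => Prod.ext ?_ (funext fun j => r.controlDeriv_toTrivial j p hp),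
    fun q hq => Prod.ext (r.ψ_symm hq) (funext fun j => r.outputDeriv_ofTrivial hE j q hq)⟩
  change (r.e.symm (s.ψ p.1, r.outputDeriv 1 p)).1 = p.1
  rw [r.outputDeriv_one hp]
  exact congrArg Prod.fst (r.symm_ψ_zd hp)

end LocalSystem.ReducedChart

/-! ### Transport between jet spaces over manifolds and over vector spaces -/

section Transport

variable {E H X : Type*} [NormedAddCommGroup E] [NormedSpace ℝ E] [TopologicalSpace H]
  [TopologicalSpace X] [ChartedSpace H X] {I : ModelWithCorners ℝ E H}
  {E' H' Y : Type*} [NormedAddCommGroup E'] [NormedSpace ℝ E'] [TopologicalSpace H']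
  [TopologicalSpace Y] [ChartedSpace H' Y] {I' : ModelWithCorners ℝ E' H'}
  {A B V : Type*} [NormedAddCommGroup A] [NormedSpace ℝ A] [NormedAddCommGroup B] [NormedSpace ℝ B]
  [NormedAddCommGroup V] [NormedSpace ℝ V] {m : ℕ}

lemma HasMFDerivAt.prodMap_id_space {κ : X → A} {x : X} {κ' : TangentSpace I x →L[ℝ] A}
    (hκ : HasMFDerivAt I 𝓘(ℝ, A) κ x κ') (b : B) :
    HasMFDerivAt (I.prod 𝓘(ℝ, B)) 𝓘(ℝ, A × B) (fun q : X × B => (κ q.1, q.2)) (x, b)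
      (ContinuousLinearMap.prodMap (M₁ := E) κ' (ContinuousLinearMap.id ℝ B)) := by
  rw [modelWithCornersSelf_prod, ← chartedSpaceSelf_prod]
  exact (HasMFDerivAt.comp (x, b) hκ (hasMFDerivAt_fst (x, b))).prodMk (hasMFDerivAt_snd (x, b))

lemma ContMDiffOn.prodMap_id_space {κ : X → A} {O : Set X} {S : Set (X × B)}
    (hκ : ContMDiffOn I 𝓘(ℝ, A) ∞ κ O) (hS : ∀ q ∈ S, q.1 ∈ O) :
    ContMDiffOn (I.prod 𝓘(ℝ, B)) 𝓘(ℝ, A × B) ∞ (fun q : X × B => (κ q.1, q.2)) S :=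
  (hκ.comp contMDiffOn_fst hS).prodMk_space contMDiffOn_snd

lemma JetSmoothOn.smoothOn_comp {h : A × Jets m → V} {T : Set (A × Jets m)} (hh : JetSmoothOn h T)
    {κ : X → A} {O : Set X} (hκ : ContMDiffOn I 𝓘(ℝ, A) ∞ κ O) {σ : V → Y} {R : Set V}
    (hσ : ContMDiffOn 𝓘(ℝ, V) I' ∞ σ R) {S : Set (X × Jets m)} (hSO : ∀ p ∈ S, p.1 ∈ O)
    (hST : ∀ p ∈ S, (κ p.1, p.2) ∈ T) (hTR : ∀ q ∈ T, h q ∈ R) :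
    SmoothOn I I' (fun p => σ (h (κ p.1, p.2))) S := by
  obtain ⟨N, F, hF, hhF⟩ := hh
  refine ⟨N, fun q => σ (F (κ q.1, q.2)), ?_, fun p hp => ?_⟩
  · refine hσ.comp (t := R) (ContMDiffOn.comp (t := trunc N '' T) hF.contMDiffOn
      (ContMDiffOn.prodMap_id_space hκ ?_) ?_) ?_
    · rintro _ ⟨p, hp, rfl⟩
      exact hSO p hp
    · rintro _ ⟨p, hp, rfl⟩
      exact ⟨_, hST p hp, rfl⟩
    · rintro _ ⟨p, hp, rfl⟩
      have h1 := hTR _ (hST p hp)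
      rw [hhF _ (hST p hp)] at h1
      exact h1
  · exact congrArg σ (hhF _ (hST p hp))

lemma JetSmoothOn.hasDerivAlong_comp {h : A × Jets m → V} {T : Set (A × Jets m)}
    (hh : JetSmoothOn h T) (hT : IsOpen T) {κ : X → A} {p : X × Jets m}
    (hp : (κ p.1, p.2) ∈ T) {κ' : TangentSpace I p.1 →L[ℝ] A}
    (hκ : HasMFDerivAt I 𝓘(ℝ, A) κ p.1 κ') {σ : V → Y}
    {σ' : V →L[ℝ] TangentSpace I' (σ (h (κ p.1, p.2)))}
    (hσ : HasMFDerivAt 𝓘(ℝ, V) I' σ (h (κ p.1, p.2)) σ')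
    {v : TangentSpace I p.1} {w : Jets m} {a : A} {b : V}
    {d : TangentSpace I' (σ (h (κ p.1, p.2)))} (hv : κ' v = a)
    (hb : HasLineDerivAt ℝ h b (κ p.1, p.2) (a, w)) (hd : σ' b = d) :
    HasDerivAlong I I' (fun p => σ (h (κ p.1, p.2))) p v w d := by
  obtain ⟨N, F, F', h1, h2, h3⟩ := hh.exists_hasFDerivAt hT hp
  have hκc : ContinuousAt (fun q : X × Jets m => (κ q.1, q.2)) p :=
    (hκ.continuousAt.comp continuousAt_fst).prodMk continuousAt_snd
  have h4 : h (κ p.1, p.2) = F (trunc N (κ p.1, p.2)) := h1.self_of_nhds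
  have hσ2 : HasMFDerivAt 𝓘(ℝ, V) I' σ (F (trunc N (κ p.1, p.2))) σ' := h4 ▸ hσ
  have h5 := HasMFDerivAt.comp (I' := 𝓘(ℝ, A × (Fin N → Fin m → ℝ)))
    (trunc N p) (g := F) (f := fun q : X × (Fin N → Fin m → ℝ) => (κ q.1, q.2))
    (h2.hasMFDerivAt) (HasMFDerivAt.prodMap_id_space hκ (trunc N p).2)
  have h6 := HasMFDerivAt.comp (trunc N p) (g := σ) hσ2 h5
  refine ⟨N, _, _, ?_, h6, ?_⟩
  · filter_upwards [hκc.eventually h1] with q hq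
    exact congrArg σ hq
  · subst hv
    rw [← hb.lineDeriv] at hd
    exact (congrArg σ' (h3 (κ' v, w))).trans hd

end Transport

/-! ### The system in a chart -/

section Chart

variable {E X : Type*} [NormedAddCommGroup E] [NormedSpace ℝ E] [TopologicalSpace X]
  [ChartedSpace E X] {m : ℕ}

/-- The expression of a vector field in the chart at `x₀`, in the form in which it enters the
definition of the Lie bracket on a manifold. -/
def coordField (x₀ : X) (V : (x : X) → TangentSpace 𝓘(ℝ, E) x) : E → E :=
  VectorField.mpullbackWithin 𝓘(ℝ, E) 𝓘(ℝ, E) (extChartAt 𝓘(ℝ, E) x₀).symm V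
    (Set.range 𝓘(ℝ, E))

/-- The expression of a map into `ℝᵐ` in the chart at `x₀`. -/
def coordMap (x₀ : X) (ψ : Fin m → X → ℝ) (y : E) (i : Fin m) : ℝ :=
  ψ i ((extChartAt 𝓘(ℝ, E) x₀).symm y)

variable [IsManifold 𝓘(ℝ, E) ∞ X]

lemma coordField_apply {x₀ x : X} (hx : x ∈ (extChartAt 𝓘(ℝ, E) x₀).source)
    (V : (x : X) → TangentSpace 𝓘(ℝ, E) x) :
    coordField x₀ V (extChartAt 𝓘(ℝ, E) x₀ x) =
      mfderiv 𝓘(ℝ, E) 𝓘(ℝ, E) (extChartAt 𝓘(ℝ, E) x₀) x (V x) := by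
  have h1 : (mfderivWithin 𝓘(ℝ, E) 𝓘(ℝ, E) (extChartAt 𝓘(ℝ, E) x₀).symm (Set.range 𝓘(ℝ, E))
      (extChartAt 𝓘(ℝ, E) x₀ x)).inverse = mfderiv 𝓘(ℝ, E) 𝓘(ℝ, E) (extChartAt 𝓘(ℝ, E) x₀)
        ((extChartAt 𝓘(ℝ, E) x₀).symm (extChartAt 𝓘(ℝ, E) x₀ x)) :=
    ContinuousLinearMap.inverse_eq
      (mfderivWithin_extChartAt_symm_comp_mfderiv_extChartAt
        ((extChartAt 𝓘(ℝ, E) x₀).map_source hx))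
      (mfderiv_extChartAt_comp_mfderivWithin_extChartAt_symm
        ((extChartAt 𝓘(ℝ, E) x₀).map_source hx))
  rw [coordField, VectorField.mpullbackWithin_apply, h1, (extChartAt 𝓘(ℝ, E) x₀).left_inv hx]

lemma contDiffOn_coordField [CompleteSpace E] (x₀ : X) {V : (x : X) → TangentSpace 𝓘(ℝ, E) x}
    (hV : SmoothField 𝓘(ℝ, E) V) :
    ContDiffOn ℝ ∞ (coordField x₀ V) (extChartAt 𝓘(ℝ, E) x₀).target := by
  refine contMDiffOn_vectorSpace_iff_contDiffOn.1 fun y hy => ?_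
  refine ContMDiffWithinAt.mpullbackWithin_vectorField' (n := ∞) (t := Set.univ)
    (hV _).contMDiffWithinAt
    (contMDiffWithinAt_extChartAt_symm_range x₀ hy)
    (isInvertible_mfderivWithin_extChartAt_symm hy) hy
    (isOpen_extChartAt_target x₀).uniqueMDiffOn (by simp) (by simp)
    (extChartAt_target_subset_range x₀)

omit [IsManifold 𝓘(ℝ, E) ∞ X] in
lemma coordField_affine (x₀ : X) (f₀ : (x : X) → TangentSpace 𝓘(ℝ, E) x)
    (f : Fin m → (x : X) → TangentSpace 𝓘(ℝ, E) x) (u : Fin m → ℝ) (y : E) :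
    coordField x₀ (fun x => affine 𝓘(ℝ, E) f₀ f x u) y =
      coordField x₀ f₀ y + ∑ j, u j • coordField x₀ (f j) y := by
  simp only [coordField, VectorField.mpullbackWithin_apply, affine, map_add, map_sum, map_smul]
  rfl

omit [IsManifold 𝓘(ℝ, E) ∞ X] in
lemma mlieBracket_eq_lieBracket_coordField [IsManifold 𝓘(ℝ, E) 1 X] (x₀ : X)
    (V W : (x : X) → TangentSpace 𝓘(ℝ, E) x) :
    VectorField.mlieBracket 𝓘(ℝ, E) V W x₀ =
      VectorField.lieBracket ℝ (coordField x₀ V) (coordField x₀ W)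
        (extChartAt 𝓘(ℝ, E) x₀ x₀) := by
  have h : ((mfderiv 𝓘(ℝ, E) 𝓘(ℝ, E) (extChartAt 𝓘(ℝ, E) x₀) x₀ : E →L[ℝ] E)).inverse =
      ContinuousLinearMap.id ℝ E := by
    rw [mfderiv_extChartAt_self]
    exact ContinuousLinearMap.inverse_id
  rw [← VectorField.mlieBracketWithin_univ, VectorField.mlieBracketWithin_apply,
    ← VectorField.lieBracketWithin_univ]
  refine (congrArg (fun L : E →L[ℝ] E => L _) h).trans ?_
  simp only [Set.preimage_univ, Set.univ_inter, modelWithCornersSelf_coe, Set.range_id,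
    coordField]
  rfl

section FirstIntegral

variable {U : Set X} {x₀ : X} {ψ : Fin m → X → ℝ}

lemma contDiffOn_coordMap (hψ : ∀ i, ContMDiffOn 𝓘(ℝ, E) 𝓘(ℝ, ℝ) ∞ (ψ i) U) :
    ContDiffOn ℝ ∞ (coordMap x₀ ψ)
      ((extChartAt 𝓘(ℝ, E) x₀).target ∩ (extChartAt 𝓘(ℝ, E) x₀).symm ⁻¹' U) := by
  refine contDiffOn_pi.2 fun i => ContMDiffOn.contDiffOn ?_
  exact (hψ i).comp ((contMDiffOn_extChartAt_symm x₀).mono Set.inter_subset_left) fun y hy => hy.2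

omit [IsManifold 𝓘(ℝ, E) ∞ X] in
lemma isOpen_target_inter_preimage (hU : IsOpen U) :
    IsOpen ((extChartAt 𝓘(ℝ, E) x₀).target ∩ (extChartAt 𝓘(ℝ, E) x₀).symm ⁻¹' U) :=
  (continuousOn_extChartAt_symm x₀).isOpen_inter_preimage (isOpen_extChartAt_target x₀) hU

omit [IsManifold 𝓘(ℝ, E) ∞ X] in
lemma extChartAt_mem_of_mem {x : X} (hx : x ∈ (extChartAt 𝓘(ℝ, E) x₀).source) (hxU : x ∈ U) :
    extChartAt 𝓘(ℝ, E) x₀ x ∈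
      (extChartAt 𝓘(ℝ, E) x₀).target ∩ (extChartAt 𝓘(ℝ, E) x₀).symm ⁻¹' U :=
  ⟨(extChartAt 𝓘(ℝ, E) x₀).map_source hx, by
    simpa only [Set.mem_preimage, (extChartAt 𝓘(ℝ, E) x₀).left_inv hx] using hxU⟩

lemma hasMFDerivAt_extChartAt_mfderiv {x : X} (hx : x ∈ (extChartAt 𝓘(ℝ, E) x₀).source) :
    HasMFDerivAt 𝓘(ℝ, E) 𝓘(ℝ, E) (extChartAt 𝓘(ℝ, E) x₀) x
      (mfderiv 𝓘(ℝ, E) 𝓘(ℝ, E) (extChartAt 𝓘(ℝ, E) x₀) x) :=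
  (mdifferentiableAt_extChartAt (I := 𝓘(ℝ, E)) (by simpa using hx)).hasMFDerivAt

lemma differential_eq_coordMap (hU : IsOpen U)
    (hψ : ∀ i, ContMDiffOn 𝓘(ℝ, E) 𝓘(ℝ, ℝ) ∞ (ψ i) U) {x : X}
    (hx : x ∈ (extChartAt 𝓘(ℝ, E) x₀).source) (hxU : x ∈ U) (i : Fin m)
    (v : TangentSpace 𝓘(ℝ, E) x) :
    differential 𝓘(ℝ, E) (ψ i) x v = fderiv ℝ (coordMap x₀ ψ) (extChartAt 𝓘(ℝ, E) x₀ x)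
      (mfderiv 𝓘(ℝ, E) 𝓘(ℝ, E) (extChartAt 𝓘(ℝ, E) x₀) x v) i := by
  have h1 : HasFDerivAt (coordMap x₀ ψ) _ (extChartAt 𝓘(ℝ, E) x₀ x) :=
    (((contDiffOn_coordMap hψ).contDiffAt
      ((isOpen_target_inter_preimage hU).mem_nhds (extChartAt_mem_of_mem hx hxU))).differentiableAt
        (by simp)).hasFDerivAt
  have h2 := (hasFDerivAt_pi'.1 h1 i).hasMFDerivAt
  have h3 := HasMFDerivAt.comp x h2 (hasMFDerivAt_extChartAt_mfderiv hx)
  have h4 : ψ i =ᶠ[𝓝 x] (fun y => coordMap x₀ ψ y i) ∘ extChartAt 𝓘(ℝ, E) x₀ := by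
    filter_upwards [(isOpen_extChartAt_source x₀).mem_nhds hx] with x' hx'
    simp only [coordMap, Function.comp_apply, (extChartAt 𝓘(ℝ, E) x₀).left_inv hx']
  exact congrArg (fun L => L v) (h3.congr_of_eventuallyEq h4).mfderiv

end FirstIntegral

/-- The system, with its first integrals, in the chart at `x₀`. -/
def chartSystem [CompleteSpace E] (x₀ : X) {f₀ : (x : X) → TangentSpace 𝓘(ℝ, E) x}
    {f : Fin m → (x : X) → TangentSpace 𝓘(ℝ, E) x} (hf₀ : SmoothField 𝓘(ℝ, E) f₀)
    (hf : ∀ j, SmoothField 𝓘(ℝ, E) (f j)) (k : Fin m) {U : Set X} (hU : IsOpen U)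
    {ψ : Fin m → X → ℝ} (hψ : ∀ i, IsFirstIntegralOn 𝓘(ℝ, E) (f k) (ψ i) U) :
    LocalSystem E m where
  f₀ := coordField x₀ f₀
  f j := coordField x₀ (f j)
  k := k
  ψ := coordMap x₀ ψ
  D := (extChartAt 𝓘(ℝ, E) x₀).target ∩ (extChartAt 𝓘(ℝ, E) x₀).symm ⁻¹' U
  isOpen_D := isOpen_target_inter_preimage hU
  contDiffOn_f₀ := (contDiffOn_coordField x₀ hf₀).mono Set.inter_subset_left
  contDiffOn_f j := (contDiffOn_coordField x₀ (hf j)).mono Set.inter_subset_left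
  contDiffOn_ψ := contDiffOn_coordMap fun i => (hψ i).smooth
  fderiv_ψ_f := by
    rintro y ⟨hy, hyU⟩
    have hx := (extChartAt 𝓘(ℝ, E) x₀).map_target hy
    ext i
    have h := differential_eq_coordMap hU (fun i => (hψ i).smooth) hx hyU i
      (f k ((extChartAt 𝓘(ℝ, E) x₀).symm y))
    rw [(hψ i).lieDeriv_eq_zero _ hyU, ← coordField_apply hx,
      (extChartAt 𝓘(ℝ, E) x₀).right_inv hy] at h
    exact h.symm

end Chart

section ChartSystem

variable {E X : Type*} [NormedAddCommGroup E] [NormedSpace ℝ E] [TopologicalSpace X]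
  [ChartedSpace E X] {m : ℕ} [IsManifold 𝓘(ℝ, E) ∞ X] [FiniteDimensional ℝ E] {x₀ : X}
  {f₀ : (x : X) → TangentSpace 𝓘(ℝ, E) x} {f : Fin m → (x : X) → TangentSpace 𝓘(ℝ, E) x}
  {hf₀ : SmoothField 𝓘(ℝ, E) f₀} {hf : ∀ j, SmoothField 𝓘(ℝ, E) (f j)} {k : Fin m}
  {U : Set X} {hU : IsOpen U} {ψ : Fin m → X → ℝ}
  {hψ : ∀ i, IsFirstIntegralOn 𝓘(ℝ, E) (f k) (ψ i) U}

lemma mfderiv_extChartAt_affine {x : X} (hx : x ∈ (extChartAt 𝓘(ℝ, E) x₀).source)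
    (u : Fin m → ℝ) :
    mfderiv 𝓘(ℝ, E) 𝓘(ℝ, E) (extChartAt 𝓘(ℝ, E) x₀) x (affine 𝓘(ℝ, E) f₀ f x u) =
      (chartSystem x₀ hf₀ hf k hU hψ).g (extChartAt 𝓘(ℝ, E) x₀ x) u := by
  rw [← coordField_apply hx fun x => affine 𝓘(ℝ, E) f₀ f x u, coordField_affine]
  rfl

lemma zDot_eq_zd {q : X × (Fin m → ℝ)} (hx : q.1 ∈ (extChartAt 𝓘(ℝ, E) x₀).source)
    (hxU : q.1 ∈ U) :
    zDot 𝓘(ℝ, E) (affine 𝓘(ℝ, E) f₀ f) ψ q =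
      (chartSystem x₀ hf₀ hf k hU hψ).zd (extChartAt 𝓘(ℝ, E) x₀ q.1, q.2) := by
  ext i
  rw [zDot, differential_eq_coordMap hU (fun i => (hψ i).smooth) hx hxU,
    mfderiv_extChartAt_affine (hf₀ := hf₀) (hf := hf) (hU := hU) (hψ := hψ) hx]
  rfl

lemma zDDot_eq_zdd {q : X × (Fin m → ℝ)} (hx : q.1 ∈ (extChartAt 𝓘(ℝ, E) x₀).source)
    (hxU : q.1 ∈ U) (w : Fin m → ℝ) :
    zDDot 𝓘(ℝ, E) (affine 𝓘(ℝ, E) f₀ f) ψ q w =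
      (chartSystem x₀ hf₀ hf k hU hψ).zdd (extChartAt 𝓘(ℝ, E) x₀ q.1, q.2) w := by
  set s := chartSystem x₀ hf₀ hf k hU hψ with hs
  ext i
  have h1 : HasFDerivAt s.zd (fderiv ℝ s.zd (extChartAt 𝓘(ℝ, E) x₀ q.1, q.2))
      (extChartAt 𝓘(ℝ, E) x₀ q.1, q.2) :=
    (s.differentiableAt_zd (q := (extChartAt 𝓘(ℝ, E) x₀ q.1, q.2))
      (extChartAt_mem_of_mem hx hxU)).hasFDerivAt
  have h2 := HasMFDerivAt.comp (f := fun q : X × (Fin m → ℝ) => (extChartAt 𝓘(ℝ, E) x₀ q.1, q.2))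
    q (hasFDerivAt_pi'.1 h1 i).hasMFDerivAt
    (HasMFDerivAt.prodMap_id_space (hasMFDerivAt_extChartAt_mfderiv hx) q.2)
  have h3 : (fun q' => zDot 𝓘(ℝ, E) (affine 𝓘(ℝ, E) f₀ f) ψ q' i) =ᶠ[𝓝 q]
      (fun y => s.zd y i) ∘ fun q => (extChartAt 𝓘(ℝ, E) x₀ q.1, q.2) := by
    have hO : {q : X × (Fin m → ℝ) | q.1 ∈ (extChartAt 𝓘(ℝ, E) x₀).source ∩ U} ∈ 𝓝 q :=
      (((isOpen_extChartAt_source x₀).inter hU).preimage continuous_fst).mem_nhds ⟨hx, hxU⟩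
    filter_upwards [hO] with q' hq'
    exact congrFun (zDot_eq_zd hq'.1 hq'.2) i
  have h4 := (h2.congr_of_eventuallyEq h3).mfderiv
  have h5 := congrArg (fun L => L (affine 𝓘(ℝ, E) f₀ f q.1 q.2, w)) h4
  refine Eq.trans h5 ?_
  rw [LocalSystem.zdd, ← mfderiv_extChartAt_affine (hf₀ := hf₀) (hf := hf) (hU := hU) (hψ := hψ) hx]
  rfl

omit [IsManifold 𝓘(ℝ, E) ∞ X] [FiniteDimensional ℝ E] in
/-- A family of independent linear forms is jointly surjective. -/
lemma surjective_of_linearIndependent {L : E →L[ℝ] (Fin m → ℝ)}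
    (h : LinearIndependent ℝ fun i =>
      (ContinuousLinearMap.proj (R := ℝ) (φ := fun _ => ℝ) i).comp L) :
    Function.Surjective L := by
  change Function.Surjective L.toLinearMap
  rw [← LinearMap.dualMap_injective_iff, injective_iff_map_eq_zero]
  intro ℓ hℓ
  have h1 : ∑ i, ℓ (Pi.single i 1) •
      (ContinuousLinearMap.proj (R := ℝ) (φ := fun _ => ℝ) i).comp L = 0 := by
    ext v
    have h2 := congrArg (fun T => T v) hℓ
    simp only [LinearMap.dualMap_apply] at h2
    rw [LinearMap.pi_apply_eq_sum_univ ℓ] at h2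
    have h3 : ∀ i : Fin m, (fun j => if i = j then (1 : ℝ) else 0) = Pi.single i 1 := fun i => by
      ext j
      simp [Pi.single_apply, eq_comm]
    simp only [h3] at h2
    simpa [mul_comm] using h2
  have h3 := Fintype.linearIndependent_iff.1 h _ h1
  refine LinearMap.pi_ext' fun i => LinearMap.ext_ring ?_
  simpa using h3 i

lemma exists_chartSystem_reducedChart (hE : Module.finrank ℝ E = m + 1) (hxU : x₀ ∈ U)
    {u₀ : Fin m → ℝ}
    (hspan : Submodule.span ℝ (Set.range (fun j => f j x₀) ∪
        {VectorField.mlieBracket 𝓘(ℝ, E) (fun x => affine 𝓘(ℝ, E) f₀ f x u₀) (f k) x₀}) = ⊤)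
    (hind : LinearIndependent ℝ fun i => differential 𝓘(ℝ, E) (ψ i) x₀) :
    ∃ r : (chartSystem x₀ hf₀ hf k hU hψ).ReducedChart,
      (extChartAt 𝓘(ℝ, E) x₀ x₀, u₀) ∈ r.W := by
  have hx := mem_extChartAt_source (I := 𝓘(ℝ, E)) x₀
  -- The differential of the chart at its base point is the identity.
  have hid : ∀ v : TangentSpace 𝓘(ℝ, E) x₀,
      mfderiv 𝓘(ℝ, E) 𝓘(ℝ, E) (extChartAt 𝓘(ℝ, E) x₀) x₀ v = v := fun v => by
    rw [mfderiv_extChartAt_self]; rfl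
  refine (chartSystem x₀ hf₀ hf k hU hψ).exists_reducedChart hE
    (extChartAt_mem_of_mem hx hxU) u₀ ?_ (surjective_of_linearIndependent ?_)
  · rw [mlieBracket_eq_lieBracket_coordField] at hspan
    have h1 : (fun j => f j x₀) =
        fun j => coordField x₀ (f j) (extChartAt 𝓘(ℝ, E) x₀ x₀) := by
      ext1 j
      rw [coordField_apply hx, hid]
    have h2 : coordField x₀ (fun x => affine 𝓘(ℝ, E) f₀ f x u₀) =
        fun y => (chartSystem x₀ hf₀ hf k hU hψ).g y u₀ := by
      ext1 y
      rw [coordField_affine]; rfl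
    rw [h1, h2] at hspan
    exact hspan
  · have h : (fun i => differential 𝓘(ℝ, E) (ψ i) x₀) = fun i =>
        (ContinuousLinearMap.proj (R := ℝ) (φ := fun _ => ℝ) i).comp
          (fderiv ℝ (coordMap x₀ ψ) (extChartAt 𝓘(ℝ, E) x₀ x₀)) := by
      ext i v
      rw [differential_eq_coordMap hU (fun i => (hψ i).smooth) hx hxU, hid]
      rfl
    rw [h] at hind
    exact hind

end ChartSystem

/-! ### Flatness on the manifold -/

section Conclusion

variable {E X : Type*} [NormedAddCommGroup E] [NormedSpace ℝ E] [TopologicalSpace X]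
  [ChartedSpace E X] {m : ℕ} [IsManifold 𝓘(ℝ, E) ∞ X] [FiniteDimensional ℝ E] {x₀ : X}
  {f₀ : (x : X) → TangentSpace 𝓘(ℝ, E) x} {f : Fin m → (x : X) → TangentSpace 𝓘(ℝ, E) x}
  {hf₀ : SmoothField 𝓘(ℝ, E) f₀} {hf : ∀ j, SmoothField 𝓘(ℝ, E) (f j)} {k : Fin m}
  {U : Set X} {hU : IsOpen U} {ψ : Fin m → X → ℝ}
  {hψ : ∀ i, IsFirstIntegralOn 𝓘(ℝ, E) (f k) (ψ i) U}

/-- The set of all `(x, u)` with `x` in the chart domain and `(y, u) ∈ r.W`, where `y` is the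
coordinate of `x`. -/
def chartDomain (r : (chartSystem x₀ hf₀ hf k hU hψ).ReducedChart) : Set (X × (Fin m → ℝ)) :=
  {q | q.1 ∈ (extChartAt 𝓘(ℝ, E) x₀).source ∧ (extChartAt 𝓘(ℝ, E) x₀ q.1, q.2) ∈ r.W}

variable (r : (chartSystem x₀ hf₀ hf k hU hψ).ReducedChart)

lemma isOpen_chartDomain : IsOpen (chartDomain r) := by
  have h : ContinuousOn (fun q : X × (Fin m → ℝ) => (extChartAt 𝓘(ℝ, E) x₀ q.1, q.2))
      ((extChartAt 𝓘(ℝ, E) x₀).source ×ˢ Set.univ) :=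
    ((continuousOn_extChartAt x₀).comp continuousOn_fst fun q hq => hq.1).prodMk continuousOn_snd
  convert! h.isOpen_inter_preimage ((isOpen_extChartAt_source x₀).prod isOpen_univ) r.isOpen_W
    using 1
  ext q
  simp [chartDomain]

variable {r} in
lemma mem_of_mem_chartDomain {q : X × (Fin m → ℝ)} (hq : q ∈ chartDomain r) : q.1 ∈ U := by
  have h := (r.mem_D_of_mem_W hq.2).2
  simpa only [Set.mem_preimage, (extChartAt 𝓘(ℝ, E) x₀).left_inv hq.1] using h

lemma symm_mem_chartDomain {q : E × (Fin m → ℝ)} (hq : q ∈ r.W) :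
    ((extChartAt 𝓘(ℝ, E) x₀).symm q.1, q.2) ∈ chartDomain r := by
  have h := (r.mem_D_of_mem_W hq).1
  refine ⟨(extChartAt 𝓘(ℝ, E) x₀).map_target h, ?_⟩
  simpa only [(extChartAt 𝓘(ℝ, E) x₀).right_inv h] using hq

lemma right_inv_of_mem_W {q : E × (Fin m → ℝ)} (hq : q ∈ r.W) :
    extChartAt 𝓘(ℝ, E) x₀ ((extChartAt 𝓘(ℝ, E) x₀).symm q.1) = q.1 :=
  (extChartAt 𝓘(ℝ, E) x₀).right_inv (r.mem_D_of_mem_W hq).1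

omit [FiniteDimensional ℝ E] in
lemma contMDiffOn_extChartAt_source (x₀ : X) :
    ContMDiffOn 𝓘(ℝ, E) 𝓘(ℝ, E) ∞ (extChartAt 𝓘(ℝ, E) x₀) (extChartAt 𝓘(ℝ, E) x₀).source := by
  rw [extChartAt_source]
  exact contMDiffOn_extChartAt

omit [FiniteDimensional ℝ E] in
lemma hasMFDerivAt_extChartAt_symm {y : E} (hy : y ∈ (extChartAt 𝓘(ℝ, E) x₀).target) :
    HasMFDerivAt 𝓘(ℝ, E) 𝓘(ℝ, E) (extChartAt 𝓘(ℝ, E) x₀).symm y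
      (mfderivWithin 𝓘(ℝ, E) 𝓘(ℝ, E) (extChartAt 𝓘(ℝ, E) x₀).symm (Set.range 𝓘(ℝ, E)) y) := by
  have h := (mdifferentiableWithinAt_extChartAt_symm (I := 𝓘(ℝ, E)) hy).hasMFDerivWithinAt
  simpa only [modelWithCornersSelf_coe, Set.range_id, hasMFDerivWithinAt_univ] using h

lemma mfderiv_symm_g {y : E} (hy : y ∈ (extChartAt 𝓘(ℝ, E) x₀).target) (u : Fin m → ℝ) :
    mfderivWithin 𝓘(ℝ, E) 𝓘(ℝ, E) (extChartAt 𝓘(ℝ, E) x₀).symm (Set.range 𝓘(ℝ, E)) y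
      ((chartSystem x₀ hf₀ hf k hU hψ).g y u) =
        affine 𝓘(ℝ, E) f₀ f ((extChartAt 𝓘(ℝ, E) x₀).symm y) u := by
  have h := mfderiv_extChartAt_affine (hf₀ := hf₀) (hf := hf) (hU := hU) (hψ := hψ)
    ((extChartAt 𝓘(ℝ, E) x₀).map_target hy) u
  rw [(extChartAt 𝓘(ℝ, E) x₀).right_inv hy] at h
  rw [← h]
  exact congrArg (fun L => L (affine 𝓘(ℝ, E) f₀ f ((extChartAt 𝓘(ℝ, E) x₀).symm y) u))
    (mfderivWithin_extChartAt_symm_comp_mfderiv_extChartAt (I := 𝓘(ℝ, E)) hy)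

/-- The Lie-Bäcklund isomorphism in coordinates, composed with the chart. -/
theorem isFlatOutputOn_chartDomain (hE : Module.finrank ℝ E = m + 1) :
    IsFlatOutputOn 𝓘(ℝ, E) (affine 𝓘(ℝ, E) f₀ f) (fun p i => ψ i p.1)
      (cylinder (chartDomain r)) := by
  set φ := extChartAt 𝓘(ℝ, E) x₀ with hφ
  have hST : ∀ p ∈ cylinder (chartDomain r), (φ p.1, p.2) ∈ r.jetSource := fun p hp => hp.2
  have hTS : ∀ q ∈ r.jetTarget,
      (φ.symm (r.ofTrivial q).1, (r.ofTrivial q).2) ∈ cylinder (chartDomain r) := fun q hq =>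
    symm_mem_chartDomain r (r.mapsTo_ofTrivial hq)
  have hκ := contMDiffOn_extChartAt_source (E := E) x₀
  have hid : ∀ {V : Type} [NormedAddCommGroup V] [NormedSpace ℝ V],
      ContMDiffOn 𝓘(ℝ, V) 𝓘(ℝ, V) ∞ (id : V → V) Set.univ := contMDiffOn_id
  refine ⟨r.jetTarget, fun p => r.toTrivial (φ p.1, p.2),
    fun q => (φ.symm (r.ofTrivial q).1, (r.ofTrivial q).2), ?_, fun p hp => ?_⟩
  · refine ⟨(isOpen_chartDomain r).preimage (by fun_prop), r.isOpen_jetTarget,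
      fun p hp => r.mapsTo_toTrivial (hST p hp), hTS, ⟨fun p hp => ?_, fun q hq => ?_⟩,
      ⟨?_, fun j => ?_⟩, ⟨?_, fun j => ?_⟩, fun p hp => ⟨?_, fun j => ?_⟩,
      fun q hq => ⟨?_, fun j => ?_⟩⟩
    · have h := (r.invOn_toTrivial hE).1 (hST p hp)
      simp only [h, φ.left_inv hp.1, Prod.mk.eta]
    · simp only [hφ, right_inv_of_mem_W r (r.mapsTo_ofTrivial hq), Prod.mk.eta]
      exact (r.invOn_toTrivial hE).2 hq
    · exact r.jetSmoothOn_ψ.smoothOn_comp hκ hid (fun p hp => hp.1) hST fun _ _ => trivial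
    · exact (r.jetSmoothOn_outputDeriv (j + 1)).smoothOn_comp hκ hid (fun p hp => hp.1) hST
        fun _ _ => trivial
    · exact r.jetSmoothOn_symm.smoothOn_comp (κ := id) (O := Set.univ) (σ := fun p => φ.symm p.1)
        (R := Prod.fst ⁻¹' φ.target) contMDiffOn_id
        ((contMDiffOn_extChartAt_symm x₀).comp contDiff_fst.contMDiff.contMDiffOn fun _ h => h)
        (fun _ _ => trivial) (fun _ hq => hq)
        fun q hq => (r.mem_D _ (r.e.map_target hq)).1
    · exact (r.jetSmoothOn_controlDeriv j).smoothOn_comp (κ := id) (O := Set.univ)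
        contMDiffOn_id hid (fun _ _ => trivial) (fun _ hq => hq) fun _ _ => trivial
    · exact r.jetSmoothOn_ψ.hasDerivAlong_comp r.isOpen_jetSource (hST p hp)
        (hasMFDerivAt_extChartAt_mfderiv hp.1) (hasMFDerivAt_id _)
        (mfderiv_extChartAt_affine hp.1 _) (r.hasLineDerivAt_toTrivial (hST p hp)).1 rfl
    · exact (r.jetSmoothOn_outputDeriv (j + 1)).hasDerivAlong_comp r.isOpen_jetSource (hST p hp)
        (hasMFDerivAt_extChartAt_mfderiv hp.1) (hasMFDerivAt_id _)
        (mfderiv_extChartAt_affine hp.1 _) ((r.hasLineDerivAt_toTrivial (hST p hp)).2 j) rfl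
    · have hy := (r.mem_D _ (r.e.map_target hq)).1
      have h := r.jetSmoothOn_symm.hasLineDerivAt r.isOpen_jetTarget hq
        (cartanField (fun _ v => v) q)
      rw [r.lineDeriv_symm hq] at h
      refine r.jetSmoothOn_symm.hasDerivAlong_comp (κ := id) (σ := fun p => φ.symm p.1)
        r.isOpen_jetTarget hq (hasMFDerivAt_id _)
        (HasMFDerivAt.comp (r.e.symm (q.1, q.2 0)) (hasMFDerivAt_extChartAt_symm hy)
          hasFDerivAt_fst.hasMFDerivAt) rfl h ?_
      change mfderivWithin 𝓘(ℝ, E) 𝓘(ℝ, E) φ.symm (Set.range 𝓘(ℝ, E)) _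
        (r.velocity (q.1, q.2 0) (q.2 1)).1 = _
      rw [r.velocity_fst hq _ hE]
      exact mfderiv_symm_g hy _
    · exact (r.jetSmoothOn_controlDeriv j).hasDerivAlong_comp (κ := id) r.isOpen_jetTarget hq
        (hasMFDerivAt_id _) (hasMFDerivAt_id _) rfl ((r.hasLineDerivAt_ofTrivial hE hq).2 j) rfl
  · ext i
    exact congrArg (ψ i) (φ.left_inv hp.1)

/-- The inverse of `(x, u, (uᵢ')_{i ≠ k}) ↦ (z, z', z'')`. -/
def zJetInv (t : (Fin m → ℝ) × (Fin m → ℝ) × (Fin m → ℝ)) :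
    (X × (Fin m → ℝ)) × ({i : Fin m // i ≠ k} → ℝ) :=
  (((extChartAt 𝓘(ℝ, E) x₀).symm (r.e.symm (t.1, t.2.1)).1, r.control (t.1, t.2.1) t.2.2),
    (r.velocity (t.1, t.2.1) t.2.2).2)

variable {r} in
lemma zJet_eq {q : (X × (Fin m → ℝ)) × ({i : Fin m // i ≠ k} → ℝ)} (hq : q.1 ∈ chartDomain r) :
    zJet 𝓘(ℝ, E) (affine 𝓘(ℝ, E) f₀ f) ψ k q =
      (coordMap x₀ ψ (extChartAt 𝓘(ℝ, E) x₀ q.1.1),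
        (chartSystem x₀ hf₀ hf k hU hψ).zd (extChartAt 𝓘(ℝ, E) x₀ q.1.1, q.1.2),
        (chartSystem x₀ hf₀ hf k hU hψ).zdd (extChartAt 𝓘(ℝ, E) x₀ q.1.1, q.1.2)
          (extendCLM k q.2)) := by
  rw [zJet, zDot_eq_zd (hf₀ := hf₀) (hf := hf) (hU := hU) (hψ := hψ) hq.1
    (mem_of_mem_chartDomain hq), zDDot_eq_zdd (hf₀ := hf₀) (hf := hf) (hU := hU) (hψ := hψ) hq.1
    (mem_of_mem_chartDomain hq), extendCLM_eq_extendZero]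
  refine Prod.ext (funext fun i => ?_) rfl
  exact congrArg (ψ i) ((extChartAt 𝓘(ℝ, E) x₀).left_inv hq.1).symm

lemma contMDiffOn_zJet :
    ContMDiffOn ((𝓘(ℝ, E).prod 𝓘(ℝ, Fin m → ℝ)).prod 𝓘(ℝ, {i : Fin m // i ≠ k} → ℝ))
      𝓘(ℝ, (Fin m → ℝ) × (Fin m → ℝ) × (Fin m → ℝ)) ∞
      (zJet 𝓘(ℝ, E) (affine 𝓘(ℝ, E) f₀ f) ψ k) (chartDomain r ×ˢ Set.univ) := by
  let s := chartSystem x₀ hf₀ hf k hU hψ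
  have h1 : ContDiffOn ℝ ∞ (fun t : (E × (Fin m → ℝ)) × ({i : Fin m // i ≠ k} → ℝ) =>
      (s.ψ t.1.1, s.zd t.1, s.zdd t.1 (extendCLM k t.2))) ((s.D ×ˢ Set.univ) ×ˢ Set.univ) := by
    have hf1 : ContDiffOn ℝ ∞ (fun t : (E × (Fin m → ℝ)) × ({i : Fin m // i ≠ k} → ℝ) => t.1)
        ((s.D ×ˢ Set.univ) ×ˢ Set.univ) := contDiffOn_fst
    have hm : Set.MapsTo (fun t : (E × (Fin m → ℝ)) × ({i : Fin m // i ≠ k} → ℝ) => t.1)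
        ((s.D ×ˢ Set.univ) ×ˢ Set.univ) (s.D ×ˢ Set.univ) := fun t ht => ht.1
    refine (s.contDiffOn_ψ.comp hf1.fst fun t ht => ht.1.1).prodMk
      ((s.contDiffOn_zd.comp hf1 hm).prodMk ?_)
    refine ((s.contDiffOn_zd.fderiv_of_isOpen s.isOpen_prod (m := ∞) (by simp)).comp hf1
      hm).clm_apply ((s.contDiffOn_g.comp hf1 hm).prodMk ?_)
    exact (extendCLM k).contDiff.comp_contDiffOn contDiffOn_snd
  have h2 : ContMDiffOn ((𝓘(ℝ, E).prod 𝓘(ℝ, Fin m → ℝ)).prod 𝓘(ℝ, {i : Fin m // i ≠ k} → ℝ))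
      𝓘(ℝ, (E × (Fin m → ℝ)) × ({i : Fin m // i ≠ k} → ℝ)) ∞
      (fun q : (X × (Fin m → ℝ)) × ({i : Fin m // i ≠ k} → ℝ) =>
        ((extChartAt 𝓘(ℝ, E) x₀ q.1.1, q.1.2), q.2)) (chartDomain r ×ˢ Set.univ) :=
    ContMDiffOn.prodMap_id_space (ContMDiffOn.prodMap_id_space
      (contMDiffOn_extChartAt_source x₀) fun q hq => hq.1) fun q hq => hq.1
  refine (h1.contMDiffOn.comp h2 fun q hq => ?_).congr fun q hq => ?_
  · exact ⟨⟨r.mem_D_of_mem_W hq.1.2, trivial⟩, trivial⟩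
  · exact zJet_eq hq.1

lemma contMDiffOn_zJetInv :
    ContMDiffOn 𝓘(ℝ, (Fin m → ℝ) × (Fin m → ℝ) × (Fin m → ℝ))
      ((𝓘(ℝ, E).prod 𝓘(ℝ, Fin m → ℝ)).prod 𝓘(ℝ, {i : Fin m // i ≠ k} → ℝ)) ∞
      (zJetInv r) {t | (t.1, t.2.1) ∈ r.e.target} := by
  have h0 : ContDiffOn ℝ ∞ (fun t : (Fin m → ℝ) × (Fin m → ℝ) × (Fin m → ℝ) =>
      ((t.1, t.2.1), t.2.2)) {t | (t.1, t.2.1) ∈ r.e.target} :=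
    ContDiff.contDiffOn (by fun_prop)
  have hm : Set.MapsTo (fun t : (Fin m → ℝ) × (Fin m → ℝ) × (Fin m → ℝ) => ((t.1, t.2.1), t.2.2))
      {t | (t.1, t.2.1) ∈ r.e.target} (r.e.target ×ˢ Set.univ) := fun t ht => ⟨ht, trivial⟩
  refine ContMDiffOn.prodMk (ContMDiffOn.prodMk ?_ ?_) ?_
  · refine (contMDiffOn_extChartAt_symm x₀).comp
      (r.contDiffOn_symm_comp_fst.comp h0 hm).fst.contMDiffOn fun t ht => ?_
    exact (r.mem_D _ (r.e.map_target ht)).1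
  · exact (r.contDiffOn_control.comp h0 hm).contMDiffOn
  · exact (r.contDiffOn_velocity.comp h0 hm).snd.contMDiffOn

/-- The map `(x, u, (uᵢ')_{i ≠ k}) ↦ (z, z', z'')` as a diffeomorphism onto an open set. -/
def zJetHomeomorph (hE : Module.finrank ℝ E = m + 1) :
    OpenPartialHomeomorph ((X × (Fin m → ℝ)) × ({i : Fin m // i ≠ k} → ℝ))
      ((Fin m → ℝ) × (Fin m → ℝ) × (Fin m → ℝ)) where
  toFun := zJet 𝓘(ℝ, E) (affine 𝓘(ℝ, E) f₀ f) ψ k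
  invFun := zJetInv r
  source := chartDomain r ×ˢ Set.univ
  target := {t | (t.1, t.2.1) ∈ r.e.target}
  map_source' q hq := by
    rw [zJet_eq hq.1]
    exact r.ψ_zd_mem_target hq.1.2
  map_target' t ht := ⟨symm_mem_chartDomain r (r.mem_W_of_mem_target ht t.2.2), trivial⟩
  left_inv' q hq := by
    rw [zJet_eq hq.1]
    have h1 := r.symm_ψ_zd hq.1.2
    have h2 := r.control_zdd hq.1.2 (extendCLM k q.2)
    have h3 := r.velocity_zdd hq.1.2 (extendCLM k q.2)
    refine Prod.ext (Prod.ext ?_ h2) ?_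
    · exact (congrArg (fun p => (extChartAt 𝓘(ℝ, E) x₀).symm p.1) h1).trans
        ((extChartAt 𝓘(ℝ, E) x₀).left_inv hq.1.1)
    · exact (congrArg Prod.snd h3).trans (forgetCLM_extendCLM k q.2)
  right_inv' t ht := by
    have hW := r.mem_W_of_mem_target ht t.2.2
    rw [zJet_eq (symm_mem_chartDomain r hW)]
    have h0 := right_inv_of_mem_W r hW
    simp only [zJetInv]
    rw [h0]
    refine Prod.ext (r.ψ_symm ht) (Prod.ext (r.zd_control ht _) ?_)
    exact r.zdd_control ht _ hE (forgetCLM_extendCLM _ _)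
  open_source := (isOpen_chartDomain r).prod isOpen_univ
  open_target := r.e.open_target.preimage (by fun_prop)
  continuousOn_toFun := (contMDiffOn_zJet r).continuousOn
  continuousOn_invFun := (contMDiffOn_zJetInv r).continuousOn

end Conclusion

end FlatSystems

end

theorem mainTheorem1 (m : ℕ) {X : Type*} [TopologicalSpace X]
    [ChartedSpace (EuclideanSpace ℝ (Fin (m + 1))) X] [IsManifold (𝓡 (m + 1)) ∞ X]
    (f₀ : (x : X) → TangentSpace (𝓡 (m + 1)) x)
    (f : Fin m → (x : X) → TangentSpace (𝓡 (m + 1)) x)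
    (hf₀ : FlatSystems.SmoothField (𝓡 (m + 1)) f₀)
    (hf : ∀ j, FlatSystems.SmoothField (𝓡 (m + 1)) (f j))
    (x₀ : X) (u₀ : Fin m → ℝ) (k : Fin m)
    (hspan : ∀ᶠ q : X × (Fin m → ℝ) in 𝓝 (x₀, u₀),
      Submodule.span ℝ (Set.range (fun j => f j q.1) ∪
        {VectorField.mlieBracket (𝓡 (m + 1))
          (fun x => FlatSystems.affine (𝓡 (m + 1)) f₀ f x q.2) (f k) q.1}) = ⊤)
    (U : Set X) (hU : IsOpen U) (hxU : x₀ ∈ U) (ψ : Fin m → X → ℝ)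
    (hψ : ∀ i, FlatSystems.IsFirstIntegralOn (𝓡 (m + 1)) (f k) (ψ i) U)
    (hind : LinearIndependent ℝ (fun i => FlatSystems.differential (𝓡 (m + 1)) (ψ i) x₀)) :
    ∃ W : Set (X × (Fin m → ℝ)), IsOpen W ∧ (x₀, u₀) ∈ W ∧ (∀ q ∈ W, q.1 ∈ U) ∧
      FlatSystems.IsFlatOutputOn (𝓡 (m + 1)) (FlatSystems.affine (𝓡 (m + 1)) f₀ f)
        (fun p i => ψ i p.1) (FlatSystems.cylinder W) ∧
      (∀ q ∈ W, ∀ w w' : Fin m → ℝ, (∀ i, i ≠ k → w i = w' i) →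
        FlatSystems.zDDot (𝓡 (m + 1)) (FlatSystems.affine (𝓡 (m + 1)) f₀ f) ψ q w =
          FlatSystems.zDDot (𝓡 (m + 1)) (FlatSystems.affine (𝓡 (m + 1)) f₀ f) ψ q w') ∧
      (∀ q ∈ W, ∀ w : {i : Fin m // i ≠ k} → ℝ, Function.Bijective
        (mfderiv (((𝓡 (m + 1)).prod 𝓘(ℝ, Fin m → ℝ)).prod 𝓘(ℝ, {i : Fin m // i ≠ k} → ℝ))
          𝓘(ℝ, (Fin m → ℝ) × (Fin m → ℝ) × (Fin m → ℝ))
          (FlatSystems.zJet (𝓡 (m + 1)) (FlatSystems.affine (𝓡 (m + 1)) f₀ f) ψ k) (q, w))) ∧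
      ∃ e : OpenPartialHomeomorph ((X × (Fin m → ℝ)) × ({i : Fin m // i ≠ k} → ℝ))
          ((Fin m → ℝ) × (Fin m → ℝ) × (Fin m → ℝ)),
        e.source = W ×ˢ Set.univ ∧
          Set.EqOn e (FlatSystems.zJet (𝓡 (m + 1)) (FlatSystems.affine (𝓡 (m + 1)) f₀ f) ψ k)
            e.source ∧
          ContMDiffOn
            (((𝓡 (m + 1)).prod 𝓘(ℝ, Fin m → ℝ)).prod 𝓘(ℝ, {i : Fin m // i ≠ k} → ℝ))
            𝓘(ℝ, (Fin m → ℝ) × (Fin m → ℝ) × (Fin m → ℝ)) ∞ e e.source ∧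
          ContMDiffOn 𝓘(ℝ, (Fin m → ℝ) × (Fin m → ℝ) × (Fin m → ℝ))
            (((𝓡 (m + 1)).prod 𝓘(ℝ, Fin m → ℝ)).prod 𝓘(ℝ, {i : Fin m // i ≠ k} → ℝ))
            ∞ e.symm e.target := by
  have hE : Module.finrank ℝ (EuclideanSpace ℝ (Fin (m + 1))) = m + 1 := by simp
  obtain ⟨r, hr⟩ := FlatSystems.exists_chartSystem_reducedChart (hf₀ := hf₀) (hf := hf)
    (hU := hU) (hψ := hψ) hE hxU hspan.self_of_nhds hind
  have he := FlatSystems.contMDiffOn_zJet r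
  have hes := FlatSystems.contMDiffOn_zJetInv r
  have hmd : (FlatSystems.zJetHomeomorph r hE).MDifferentiable
      (((𝓡 (m + 1)).prod 𝓘(ℝ, Fin m → ℝ)).prod 𝓘(ℝ, {i : Fin m // i ≠ k} → ℝ))
      𝓘(ℝ, (Fin m → ℝ) × (Fin m → ℝ) × (Fin m → ℝ)) :=
    ⟨he.mdifferentiableOn (by simp), hes.mdifferentiableOn (by simp)⟩
  refine ⟨FlatSystems.chartDomain r, FlatSystems.isOpen_chartDomain r,
    ⟨mem_extChartAt_source x₀, hr⟩, fun q hq => FlatSystems.mem_of_mem_chartDomain hq,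
    FlatSystems.isFlatOutputOn_chartDomain r hE, fun q hq w w' hw => ?_,
    fun q hq w => hmd.mfderiv_bijective (x := (q, w)) ⟨hq, trivial⟩,
    FlatSystems.zJetHomeomorph r hE, rfl, fun _ _ => rfl, he, hes⟩
  rw [FlatSystems.zDDot_eq_zdd (hf₀ := hf₀) (hf := hf) (hU := hU) (hψ := hψ) hq.1
      (FlatSystems.mem_of_mem_chartDomain hq),
    FlatSystems.zDDot_eq_zdd (hf₀ := hf₀) (hf := hf) (hU := hU) (hψ := hψ) hq.1
      (FlatSystems.mem_of_mem_chartDomain hq)]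
  exact FlatSystems.LocalSystem.zdd_congr _ (r.mem_D_of_mem_W hq.2) (funext fun i => hw i.1 i.2)
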